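/- Let $(M^n,g)$ be a smooth Riemannian manifold with Levi-Civita connection $\nabla$, and let $\phi$ be a smooth symmetric covariant 2-tensor field on $M$; write also $\phi$ for the associated $(1,1)$-tensor, $\langle\phi(X),Y\rangle=\phi(X,Y)$. All components are taken with respect to an orthonormal basis $e_1,\dots,e_n$ of $T_xM$; further lower indices denote covariant derivatives, the last index being the last direction of differentiation, so that $f_i$, $f_{ij}$ are the components of $df$ and of the Hessian of $f$, $\phi_{ijk}=(\nabla_{e_k}\phi)(e_i,e_j)$, and $\Delta\phi_{ij}=\sum_k\phi_{ijkk}$; an index outside a parenthesis denotes the covariant derivative of the tensor whose components stand inside it. Put $\square f=\sum_{i,j}\phi_{ij}f_{ij}$, $\Delta f=\sum_i f_{ii}$, $\operatorname{tr}\phi=\sum_i\phi_{ii}$, and let $$R_{ijkl}=\langle \mathrm{Rm}(e_i,e_j)e_k,e_l\rangle,\qquad \mathrm{Rm}(U,V)W=\nabla_V\nabla_UW-\nabla_U\nabla_VW+\nabla_{[U,V]}W,\qquad \mathrm{Ric}(X,Y)=\sum_{i}\langle \mathrm{Rm}(X,e_i)Y,e_i\rangle .$$ Then for every smooth function $f:M\to\mathbb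 R$ and every $c\in\mathbb R$, at every point of $M$, $$\begin{aligned} \tfrac12\square(|\nabla f|^2)&=\langle\nabla f,\nabla(\square f)\rangle+\langle\phi(\nabla f),\nabla(\Delta f)\rangle+2\sum_{i,j,k}\phi_{ij}f_{jk}f_{ki}+2\sum_{i,j,k,m}f_if_j\phi_{im}R_{mkjk}\\ &\quad+c\sum_{i,j}(\operatorname{tr}\phi)_{ij}f_if_j-\sum_{i,j}f_if_j\Delta\phi_{ij}+\sum_{i,j}f_if_j\Big(\sum_k\phi_{ikk}-c\sum_k\phi_{kki}\Big)_j\\ &\quad+\sum_k\Big(\sum_{i,j}f_if_j(\phi_{jik}-\phi_{jki})\Big)_k-\sum_k\Big(\sum_{i,j}f_j\phi_{ij}f_{ik}\Big)_k . \end{aligned}$$ Moreover, if $\phi=g$, then $\sum_k\big(\sum_{i,j}f_j\phi_{ij}f_{ik}\big)_k=\tfrac12\Delta|\nabla f|^2$, and the formula becomes the classical Bochner formula $$\Delta|\nabla f|^2=2\langle\nabla f,\nabla(\Delta f)\rangle+2|\mathrm{Hess}\,f|^2+2\,\mathrm{Ric}(\nabla f,\nabla f).$$ -/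

import Mathlib

open Bundle Manifold
open scoped ContDiff

noncomputable section

namespace Bochner

/-- The tangent space at `x` of a manifold modelled on Euclidean `n`-space. -/
abbrev Tan (n : ℕ) {M : Type*} [TopologicalSpace M] [ChartedSpace (EuclideanSpace ℝ (Fin n)) M]
    (x : M) : Type :=
  TangentSpace (𝓡 n) x

/-- Vector fields, without regularity. -/
abbrev VField (n : ℕ) (M : Type*) [TopologicalSpace M]
    [ChartedSpace (EuclideanSpace ℝ (Fin n)) M] : Type _ :=
  (x : M) → TangentSpace (𝓡 n) x

/-- Fields of real-valued functions of `k` tangent vectors. Covariant `k`-tensor fields are those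
which are multilinear at every point; in the sequel only such fields occur. -/
abbrev Tensor (n : ℕ) (M : Type*) [TopologicalSpace M]
    [ChartedSpace (EuclideanSpace ℝ (Fin n)) M] (k : ℕ) : Type _ :=
  (x : M) → (Fin k → TangentSpace (𝓡 n) x) → ℝ

variable {n : ℕ} {M : Type*} [TopologicalSpace M] [ChartedSpace (EuclideanSpace ℝ (Fin n)) M]
  [IsManifold (𝓡 n) ∞ M]

/-- A vector field with value `v` at `x`, smooth near `x`. -/
def ext {x : M} (v : Tan n x) : VField n M :=
  FiberBundle.extend (EuclideanSpace ℝ (Fin n)) v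

/-- The derivative `v h` of a function `h` in the direction of the tangent vector `v` at `x`. -/
def dir (h : M → ℝ) {x : M} (v : Tan n x) : ℝ :=
  mvfderiv (𝓡 n) h x v

variable [RiemannianBundle (fun x : M ↦ TangentSpace (𝓡 n) x)]

/-- An orthonormal basis of the tangent space at `x`, indexed by `Fin n`. It is used only to write
traces and dual vectors, which do not depend on the choice. -/
def onb (x : M) : OrthonormalBasis (Fin n) ℝ (Tan n x) :=
  haveI : FiniteDimensional ℝ (Tan n x) :=
    inferInstanceAs (FiniteDimensional ℝ (EuclideanSpace ℝ (Fin n)))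
  (stdOrthonormalBasis ℝ (Tan n x)).reindex
    (finCongr (finrank_euclideanSpace_fin (𝕜 := ℝ) (n := n)))

/-- The vector dual to a linear functional `α` on the tangent space at `x`: `⟨sharp α, v⟩ = α v`. -/
def sharp {x : M} (α : Tan n x → ℝ) : Tan n x :=
  ∑ i, α (onb x i) • onb x i

/-- The right-hand side of the Koszul formula, that is `⟨∇_X Y, Z⟩` at `x`. -/
def koszul (X Y Z : VField n M) (x : M) : ℝ :=
  (1 / 2) * (dir (fun y ↦ inner ℝ (Y y) (Z y)) (X x) + dir (fun y ↦ inner ℝ (X y) (Z y)) (Y x)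
    - dir (fun y ↦ inner ℝ (X y) (Y y)) (Z x)
    + inner ℝ (VectorField.mlieBracket (𝓡 n) X Y x) (Z x)
    - inner ℝ (VectorField.mlieBracket (𝓡 n) X Z x) (Y x)
    - inner ℝ (VectorField.mlieBracket (𝓡 n) Y Z x) (X x))

/-- The Levi-Civita connection: `nabla Y v` is the covariant derivative `∇_v Y` of the vector field
`Y` in the direction of the tangent vector `v` at `x`. -/
def nabla (Y : VField n M) {x : M} (v : Tan n x) : Tan n x :=
  sharp fun w ↦ koszul (ext v) Y (ext w) x

/-- The covariant derivative of a covariant tensor field; the direction of differentiation is the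
last argument:
`(∇T)(v₁, …, v_k, u) = u (T(V₁, …, V_k)) - ∑ₛ T(v₁, …, ∇_u Vₛ, …, v_k)`,
where `Vₛ` is a vector field extending `vₛ`. -/
def covDeriv {k : ℕ} (T : Tensor n M k) : Tensor n M (k + 1) := fun x v ↦
  dir (fun y ↦ T y fun s ↦ ext (v s.castSucc) y) (v (Fin.last k))
    - ∑ s : Fin k, T x (Function.update (fun r ↦ v r.castSucc) s
        (nabla (ext (v s.castSucc)) (v (Fin.last k))))

variable (n) in
/-- The differential `f_i` of a function, as a tensor field. -/
def diff (f : M → ℝ) : Tensor n M 1 := covDeriv (k := 0) fun y _ ↦ f y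

variable (n) in
/-- The Hessian `f_{ij}` of a function, as a tensor field. -/
def hess (f : M → ℝ) : Tensor n M 2 := covDeriv (diff n f)

variable (n) in
/-- The gradient. -/
def grad (f : M → ℝ) : VField n M := fun _ ↦ sharp fun v ↦ dir f v

/-- The curvature tensor
`Rm(u, v)w = ∇_v ∇_u w - ∇_u ∇_v w + ∇_{[u, v]} w`, computed with vector fields extending
`u`, `v`, `w`. -/
def Rm {x : M} (u v w : Tan n x) : Tan n x :=
  nabla (fun y ↦ nabla (ext w) (ext u y)) v - nabla (fun y ↦ nabla (ext w) (ext v y)) u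
    + nabla (ext w) (VectorField.mlieBracket (𝓡 n) (ext u) (ext v) x)

/-- The components `R(a, b, c, d) = ⟨Rm(a, b)c, d⟩` of the curvature tensor. -/
def riem {x : M} (a b c d : Tan n x) : ℝ := inner ℝ (Rm a b c) d

/-- The Ricci tensor `Ric(u, v) = ∑ₖ ⟨Rm(u, eₖ)v, eₖ⟩`. -/
def ric {x : M} (u v : Tan n x) : ℝ := ∑ k, riem u (onb x k) v (onb x k)

variable (n) in
/-- The Laplacian `Δh = ∑ᵢ h_{ii}`. -/
def lap (h : M → ℝ) (x : M) : ℝ := ∑ i, hess n h x ![onb x i, onb x i]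

/-- A field of bilinear forms, seen as a 2-tensor field. -/
def toTensor (φ : (x : M) → Tan n x →L[ℝ] Tan n x →L[ℝ] ℝ) : Tensor n M 2 :=
  fun x v ↦ φ x (v 0) (v 1)

/-- The operator `□h = ∑ φ_{ij} h_{ij}` attached to `φ`. -/
def square (φ : (x : M) → Tan n x →L[ℝ] Tan n x →L[ℝ] ℝ) (h : M → ℝ) (x : M) : ℝ :=
  ∑ i, ∑ j, φ x (onb x i) (onb x j) * hess n h x ![onb x i, onb x j]

/-- The trace of `φ`. -/
def tr (φ : (x : M) → Tan n x →L[ℝ] Tan n x →L[ℝ] ℝ) (x : M) : ℝ :=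
  ∑ i, φ x (onb x i) (onb x i)

/-- The divergence `∑ₖ (α_k)_k` of a 1-tensor field. -/
def div (α : Tensor n M 1) (x : M) : ℝ := ∑ k, covDeriv α x ![onb x k, onb x k]

/-- The 1-tensor field with components `∑ₖ φ_{ikk} - c ∑ₖ φ_{kki}`. -/
def codazziForm (φ : (x : M) → Tan n x →L[ℝ] Tan n x →L[ℝ] ℝ) (c : ℝ) : Tensor n M 1 :=
  fun x v ↦ (∑ k, covDeriv (toTensor φ) x ![v 0, onb x k, onb x k])
    - c * ∑ k, covDeriv (toTensor φ) x ![onb x k, onb x k, v 0]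

/-- The 1-tensor field with components `∑_{i,j} f_i f_j (φ_{jik} - φ_{jki})`. -/
def fluxA (φ : (x : M) → Tan n x →L[ℝ] Tan n x →L[ℝ] ℝ) (f : M → ℝ) : Tensor n M 1 :=
  fun x v ↦ ∑ i, ∑ j, diff n f x ![onb x i] * diff n f x ![onb x j]
    * (covDeriv (toTensor φ) x ![onb x j, onb x i, v 0]
      - covDeriv (toTensor φ) x ![onb x j, v 0, onb x i])

/-- The 1-tensor field with components `∑_{i,j} f_j φ_{ij} f_{ik}`. -/
def fluxB (φ : (x : M) → Tan n x →L[ℝ] Tan n x →L[ℝ] ℝ) (f : M → ℝ) : Tensor n M 1 :=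
  fun x v ↦ ∑ i, ∑ j, diff n f x ![onb x j] * φ x (onb x i) (onb x j)
    * hess n f x ![onb x i, v 0]

end Bochner

end

/-! The identity is pointwise: at `x` every term is a polynomial in the components f_i, f_ij, f_ijk,
φ_ij, φ_ijk, φ_ijkl and R_ijkl. To reach components, the choices made in the definitions (`ext`,
`onb`) must be exchangeable for others. A covariant derivative depends only on the values at the
point of the fields inserted (`covFields_congr`), a trace does not depend on the orthonormal basis
(`sum_bilin_eq`), and an orthonormal basis at `x` extends to a local orthonormal frame parallel at
`x` (`exists_parallel_frame`). In such a frame the first covariant derivative of a contraction is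
the plain derivative of a sum of products.

Half of □|∇f|² is then φ_ij f_kj f_ki + φ_ij f_k f_kij. On the other side the terms in φ_ijk cancel
between ⟨∇f, ∇□f⟩ and the two divergences, the terms in c cancel since (tr φ)_ij = ∑ φ_kkij, and the
second divergence removes one of the two sums φ_ij f_jk f_ki. What is left compares derivatives
taken in different orders (`sum_commutators`). By the Ricci identities (`ricci_one`, `ricci_two`)
and the symmetries of R all of them reduce to A = ∑ f_i f_j R_kjim φ_mk and B = ∑ f_i f_j φ_im
R_mkjk, and the formula becomes -A = -B + 2B + (-A - B), which accounts for the coefficient 2 of the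
curvature term.

If φ = g, all derivatives of φ vanish and the last divergence is half of Δ|∇f|²; moved to the left
it doubles the left side. -/

open Topology VectorField

set_option linter.unusedSectionVars false

/-! ### Directional derivatives and the Levi-Civita connection from the Koszul formula. -/

noncomputable section

namespace Bochner

variable {n : ℕ} {M : Type*} [TopologicalSpace M] [ChartedSpace (EuclideanSpace ℝ (Fin n)) M]
  [IsManifold (𝓡 n) ∞ M]

/-- Differentiability at `x` of a real-valued function. -/
abbrev FDiffAt (h : M → ℝ) (x : M) : Prop := MDifferentiableAt (𝓡 n) 𝓘(ℝ, ℝ) h x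

/-- Differentiability at `x` of a vector field. -/
abbrev VDiffAt (V : VField n M) (x : M) : Prop :=
  MDifferentiableAt (𝓡 n) ((𝓡 n).prod 𝓘(ℝ, EuclideanSpace ℝ (Fin n)))
    (fun y ↦ TotalSpace.mk' (EuclideanSpace ℝ (Fin n)) y (V y)) x

/-- Smoothness at `x` of a real-valued function. -/
abbrev FSmoothAt (h : M → ℝ) (x : M) : Prop := ContMDiffAt (𝓡 n) 𝓘(ℝ, ℝ) ∞ h x

/-- Smoothness at `x` of a vector field. -/
abbrev VSmoothAt (V : VField n M) (x : M) : Prop :=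
  ContMDiffAt (𝓡 n) ((𝓡 n).prod 𝓘(ℝ, EuclideanSpace ℝ (Fin n))) ∞
    (fun y ↦ TotalSpace.mk' (EuclideanSpace ℝ (Fin n)) y (V y)) x

theorem isManifold_two : IsManifold (𝓡 n) 2 M := IsManifold.of_le (n := ∞) (by norm_cast)
theorem isManifold_three : IsManifold (𝓡 n) (minSmoothness ℝ 3) M :=
  IsManifold.of_le (n := ∞) (by simp; norm_cast)

attribute [local instance] isManifold_two isManifold_three

theorem FSmoothAt.diff {h : M → ℝ} {x : M} (hh : FSmoothAt (n := n) h x) : FDiffAt (n := n) h x :=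
  hh.mdifferentiableAt (by simp)

theorem VSmoothAt.diff {V : VField n M} {x : M} (hV : VSmoothAt V x) : VDiffAt V x :=
  hV.mdifferentiableAt (by simp)

/-- Smoothness of order ∞ at a point allows the neighbourhood to shrink with the order, so it need
not hold at nearby points. Being C¹ does propagate, and differentiability near `x` is all that is
used. -/
theorem FSmoothAt.eventually_diff {h : M → ℝ} {x : M} (hh : FSmoothAt (n := n) h x) :
    ∀ᶠ y in 𝓝 x, FDiffAt (n := n) h y :=
  ((contMDiffAt_iff_contMDiffAt_nhds (by simp)).1 (ContMDiffAt.of_le hh (m := 1) (by norm_cast))).mono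
    fun _ hy ↦ hy.mdifferentiableAt one_ne_zero

theorem VSmoothAt.eventually_diff {V : VField n M} {x : M} (hV : VSmoothAt V x) :
    ∀ᶠ y in 𝓝 x, VDiffAt V y :=
  ((contMDiffAt_iff_contMDiffAt_nhds (by simp)).1 (ContMDiffAt.of_le hV (m := 1) (by norm_cast))).mono
    fun _ hy ↦ hy.mdifferentiableAt one_ne_zero

section dir

variable {x : M} {g h : M → ℝ}

theorem dir_add_right (h : M → ℝ) (u v : Tan n x) : dir h (u + v) = dir h u + dir h v :=
  map_add _ _ _

theorem dir_smul_right (h : M → ℝ) (c : ℝ) (u : Tan n x) : dir h (c • u) = c * dir h u :=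
  map_smul _ _ _

theorem dir_sub_right (h : M → ℝ) (u v : Tan n x) : dir h (u - v) = dir h u - dir h v :=
  map_sub _ _ _

theorem dir_const (c : ℝ) (u : Tan n x) : dir (fun _ ↦ c) u = 0 := by
  simp [dir, mvfderiv_const]

theorem dir_congr (H : g =ᶠ[𝓝 x] h) (u : Tan n x) : dir g u = dir h u := by
  simp only [dir, mvfderiv, H.mfderiv_eq]
  rfl

theorem dir_add (hg : FDiffAt (n := n) g x) (hh : FDiffAt (n := n) h x) (u : Tan n x) :
    dir (fun y ↦ g y + h y) u = dir g u + dir h u := by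
  simp [dir, mvfderiv_fun_add hg hh]

theorem dir_sub (hg : FDiffAt (n := n) g x) (hh : FDiffAt (n := n) h x) (u : Tan n x) :
    dir (fun y ↦ g y - h y) u = dir g u - dir h u := by
  simp [dir, mvfderiv_fun_sub hg hh]

theorem dir_mul (hg : FDiffAt (n := n) g x) (hh : FDiffAt (n := n) h x) (u : Tan n x) :
    dir (fun y ↦ g y * h y) u = g x * dir h u + h x * dir g u := by
  simp [dir, mvfderiv_fun_mul hg hh]

theorem dir_const_mul (c : ℝ) (hh : FDiffAt (n := n) h x) (u : Tan n x) :
    dir (fun y ↦ c * h y) u = c * dir h u := by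
  rw [dir_mul mdifferentiableAt_const hh, dir_const]; ring

theorem dir_sum {ι : Type*} (s : Finset ι) {F : ι → M → ℝ}
    (hF : ∀ i ∈ s, FDiffAt (n := n) (F i) x) (u : Tan n x) :
    FDiffAt (n := n) (fun y ↦ ∑ i ∈ s, F i y) x ∧
    dir (fun y ↦ ∑ i ∈ s, F i y) u = ∑ i ∈ s, dir (F i) u := by
  classical
  induction s using Finset.induction_on with
  | empty => simpa [dir_const] using mdifferentiableAt_const
  | insert a s ha ih =>
    have hs := ih fun i hi ↦ hF i (Finset.mem_insert_of_mem hi)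
    have h1 := hF a (Finset.mem_insert_self a s)
    simp only [Finset.sum_insert ha]
    exact ⟨h1.add hs.1, by rw [dir_add h1 hs.1, hs.2]⟩

end dir

theorem ext_self {x : M} (v : Tan n x) : ext v x = v := FiberBundle.extend_apply_self _ v

theorem ext_smooth {x : M} (v : Tan n x) : VSmoothAt (ext v) x :=
  FiberBundle.contMDiffAt_extend ..

theorem ext_diff {x : M} (v : Tan n x) : VDiffAt (ext v) x := (ext_smooth v).diff

variable [RiemannianBundle (fun x : M ↦ TangentSpace (𝓡 n) x)]
    [IsContMDiffRiemannianBundle (𝓡 n) ∞ (EuclideanSpace ℝ (Fin n))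
      (fun x : M ↦ TangentSpace (𝓡 n) x)]

theorem VDiffAt.inner {V W : VField n M} {x : M} (hV : VDiffAt V x) (hW : VDiffAt W x) :
    FDiffAt (n := n) (fun y ↦ inner ℝ (V y) (W y)) x :=
  haveI : IsContMDiffRiemannianBundle (𝓡 n) 1 (EuclideanSpace ℝ (Fin n))
      (fun x : M ↦ TangentSpace (𝓡 n) x) := .of_le (n := ∞) (by norm_cast)
  MDifferentiableAt.inner_bundle hV hW

theorem VSmoothAt.inner {V W : VField n M} {x : M} (hV : VSmoothAt V x) (hW : VSmoothAt W x) :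
    FSmoothAt (n := n) (fun y ↦ inner ℝ (V y) (W y)) x :=
  ContMDiffAt.inner_bundle hV hW

/-- The derivatives of `f` along `Y` and `Z` produced by the product rule cancel those produced by
the brackets [fX, Y] and [fX, Z]. -/
theorem koszul_tensorial_fst {Y Z : VField n M} {x : M} (hY : VDiffAt Y x) (hZ : VDiffAt Z x) :
    TensorialAt (𝓡 n) (EuclideanSpace ℝ (Fin n)) (fun X ↦ koszul X Y Z x) x where
  smul {f X} hf hX := by
    simp only [koszul, Pi.smul_apply', real_inner_smul_left, dir_smul_right,
      dir_mul hf (VDiffAt.inner hX hZ), dir_mul hf (VDiffAt.inner hX hY),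
      mlieBracket_smul_left hf hX]
    simp only [inner_add_left, real_inner_smul_left, real_inner_smul_right]
    simp [dir]
    ring
  add {X X'} hX hX' := by
    simp only [koszul, Pi.add_apply, inner_add_left, inner_add_right, dir_add_right,
      dir_add (VDiffAt.inner hX hZ) (VDiffAt.inner hX' hZ),
      dir_add (VDiffAt.inner hX hY) (VDiffAt.inner hX' hY),
      mlieBracket_add_left hX hX']
    ring

theorem koszul_tensorial_trd {X Y : VField n M} {x : M} (hX : VDiffAt X x) (hY : VDiffAt Y x) :
    TensorialAt (𝓡 n) (EuclideanSpace ℝ (Fin n)) (fun Z ↦ koszul X Y Z x) x where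
  smul {f Z} hf hZ := by
    simp only [koszul, Pi.smul_apply', real_inner_smul_right, dir_smul_right,
      dir_mul hf (VDiffAt.inner hX hZ), dir_mul hf (VDiffAt.inner hY hZ),
      mlieBracket_smul_right hf hZ]
    simp only [inner_add_left, real_inner_smul_left, real_inner_comm (X x) (Z x),
      real_inner_comm (Y x) (Z x)]
    simp [dir]
    ring
  add {Z Z'} hZ hZ' := by
    simp only [koszul, Pi.add_apply, inner_add_left, inner_add_right, dir_add_right,
      dir_add (VDiffAt.inner hX hZ) (VDiffAt.inner hX hZ'),
      dir_add (VDiffAt.inner hY hZ) (VDiffAt.inner hY hZ'),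
      mlieBracket_add_right hZ hZ']
    ring

theorem sharp_inner {x : M} (α : Tan n x →ₗ[ℝ] ℝ) (w : Tan n x) :
    inner ℝ (sharp fun v ↦ α v) w = α w := by
  conv_rhs => rw [← (onb x).sum_repr' w]
  simp [sharp, sum_inner, real_inner_smul_left, mul_comm]

theorem koszul_add_snd {X Y Y' Z : VField n M} {x : M} (hX : VDiffAt X x) (hY : VDiffAt Y x)
    (hY' : VDiffAt Y' x) (hZ : VDiffAt Z x) :
    koszul X (Y + Y') Z x = koszul X Y Z x + koszul X Y' Z x := by
  simp only [koszul, Pi.add_apply, inner_add_left, inner_add_right, dir_add_right,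
      dir_add (VDiffAt.inner hY hZ) (VDiffAt.inner hY' hZ),
      dir_add (VDiffAt.inner hX hY) (VDiffAt.inner hX hY'),
      mlieBracket_add_right hY hY', mlieBracket_add_left hY hY']
  ring

/-- The derivative of `f` along `X` arises twice, from the product rule and from [X, fY], which
absorbs the factor 1/2; the derivatives along `Z` cancel. This becomes the Leibniz rule for `nabla`.
-/
theorem koszul_smul_snd {f : M → ℝ} {X Y Z : VField n M} {x : M} (hf : FDiffAt (n := n) f x)
    (hX : VDiffAt X x) (hY : VDiffAt Y x) (hZ : VDiffAt Z x) :
    koszul X (f • Y) Z x = f x * koszul X Y Z x + dir f (X x) * inner ℝ (Y x) (Z x) := by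
  simp only [koszul, Pi.smul_apply', real_inner_smul_right, real_inner_smul_left, dir_smul_right,
      dir_mul hf (VDiffAt.inner hX hY), dir_mul hf (VDiffAt.inner hY hZ),
      mlieBracket_smul_right hf hY, mlieBracket_smul_left hf hY]
  simp only [inner_add_left, real_inner_smul_left, real_inner_comm (X x) (Y x)]
  simp [dir]
  ring

/-- Metric compatibility, before `nabla` enters: all terms but the first cancel in pairs. -/
theorem koszul_symm (X Y Z : VField n M) (x : M) :
    koszul X Y Z x + koszul X Z Y x = dir (fun y ↦ inner ℝ (Y y) (Z y)) (X x) := by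
  have h (V W : VField n M) : (fun y ↦ inner ℝ (V y) (W y)) = fun y ↦ inner ℝ (W y) (V y) := by
    funext y; exact real_inner_comm _ _
  simp only [koszul, h Z Y, mlieBracket_swap_apply (V := Z) (W := Y), inner_neg_left]
  ring

theorem koszul_antisymm (X Y Z : VField n M) (x : M) :
    koszul X Y Z x - koszul Y X Z x = inner ℝ (mlieBracket (𝓡 n) X Y x) (Z x) := by
  have h (V W : VField n M) : (fun y ↦ inner ℝ (V y) (W y)) = fun y ↦ inner ℝ (W y) (V y) := by
    funext y; exact real_inner_comm _ _
  simp only [koszul, h Y X, mlieBracket_swap_apply (V := Y) (W := X), inner_neg_left]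
  ring

/-- Frees `nabla` from the extensions in its definition. Tensoriality in `Z` makes the Koszul
expression a linear functional, so that `sharp` represents it; tensoriality in `X` allows any field
with the given value. -/
theorem nabla_inner {X Y Z : VField n M} {x : M} (hX : VDiffAt X x) (hY : VDiffAt Y x)
    (hZ : VDiffAt Z x) : inner ℝ (nabla Y (X x)) (Z x) = koszul X Y Z x := by
  have h1 := koszul_tensorial_trd (ext_diff (X x)) hY
  have h2 := sharp_inner (TensorialAt.mkHom _ x h1).toLinearMap (Z x)
  have h3 : TensorialAt.mkHom _ x h1 (Z x) = koszul (ext (X x)) Y Z x :=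
    TensorialAt.mkHom_apply h1 hZ
  have h4 : koszul (ext (X x)) Y Z x = koszul X Y Z x :=
    (koszul_tensorial_fst hY hZ).pointwise (ext_diff _) hX (ext_self _)
  exact h2.trans (h3.trans h4)

theorem eq_of_inner_ext {x : M} {u v : Tan n x}
    (h : ∀ Z : VField n M, VDiffAt Z x → inner ℝ u (Z x) = inner ℝ v (Z x)) : u = v := by
  refine ext_inner_right ℝ fun w ↦ ?_
  simpa [ext_self] using h (ext w) (ext_diff w)

section nabla

variable {Y Y' : VField n M} {x : M}

theorem nabla_add (hY : VDiffAt Y x) (hY' : VDiffAt Y' x) (v : Tan n x) :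
    nabla (Y + Y') v = nabla Y v + nabla Y' v := by
  refine eq_of_inner_ext fun Z hZ ↦ ?_
  rw [← ext_self v, inner_add_left, nabla_inner (ext_diff v) (mdifferentiableAt_add_section hY hY') hZ,
    nabla_inner (ext_diff v) hY hZ, nabla_inner (ext_diff v) hY' hZ,
    koszul_add_snd (ext_diff v) hY hY' hZ]

theorem nabla_smul {f : M → ℝ} (hf : FDiffAt (n := n) f x) (hY : VDiffAt Y x) (v : Tan n x) :
    nabla (f • Y) v = f x • nabla Y v + dir f v • Y x := by
  refine eq_of_inner_ext fun Z hZ ↦ ?_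
  conv_lhs => rw [← ext_self v]
  rw [inner_add_left, real_inner_smul_left, real_inner_smul_left,
    nabla_inner (ext_diff v) (hf.smul_section hY) hZ,
    koszul_smul_snd hf (ext_diff v) hY hZ, ext_self]
  conv_rhs => rw [← ext_self v]
  rw [nabla_inner (ext_diff v) hY hZ, ext_self]

theorem nabla_add_right (hY : VDiffAt Y x) (u v : Tan n x) :
    nabla Y (u + v) = nabla Y u + nabla Y v := by
  refine eq_of_inner_ext fun Z hZ ↦ ?_
  have h := (koszul_tensorial_fst hY hZ).add (ext_diff u) (ext_diff v)
  rw [← nabla_inner (mdifferentiableAt_add_section (ext_diff u) (ext_diff v)) hY hZ,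
    ← nabla_inner (ext_diff u) hY hZ, ← nabla_inner (ext_diff v) hY hZ] at h
  simpa [ext_self, inner_add_left] using h

theorem nabla_smul_right (hY : VDiffAt Y x) (c : ℝ) (v : Tan n x) :
    nabla Y (c • v) = c • nabla Y v := by
  refine eq_of_inner_ext fun Z hZ ↦ ?_
  have hc : FDiffAt (n := n) (fun _ : M ↦ c) x := mdifferentiableAt_const
  have h := (koszul_tensorial_fst hY hZ).smul hc (ext_diff v)
  rw [← nabla_inner (hc.smul_section (ext_diff v)) hY hZ, ← nabla_inner (ext_diff v) hY hZ] at h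
  simpa [ext_self, real_inner_smul_left] using h

/-- Compatibility of the Levi-Civita connection with the metric. -/
theorem dir_inner (hY : VDiffAt Y x) (hY' : VDiffAt Y' x) (v : Tan n x) :
    dir (fun y ↦ inner ℝ (Y y) (Y' y)) v
      = inner ℝ (nabla Y v) (Y' x) + inner ℝ (Y x) (nabla Y' v) := by
  have h := koszul_symm (ext v) Y Y' x
  rw [← nabla_inner (ext_diff v) hY hY', ← nabla_inner (ext_diff v) hY' hY, ext_self] at h
  rw [← h, real_inner_comm (Y x)]

/-- The Levi-Civita connection is torsion-free. -/
theorem nabla_sub_nabla (hY : VDiffAt Y x) (hY' : VDiffAt Y' x) :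
    nabla Y' (Y x) - nabla Y (Y' x) = mlieBracket (𝓡 n) Y Y' x := by
  refine eq_of_inner_ext fun Z hZ ↦ ?_
  rw [inner_sub_left, nabla_inner hY hY' hZ, nabla_inner hY' hY hZ, koszul_antisymm]

end nabla

end Bochner

end

/-! ### Computations in the preferred chart: brackets as commutators, functions with given
differential. -/

noncomputable section

namespace Bochner

attribute [local instance] isManifold_two isManifold_three

variable {n : ℕ} {M : Type*} [TopologicalSpace M] [ChartedSpace (EuclideanSpace ℝ (Fin n)) M]
  [IsManifold (𝓡 n) ∞ M]

theorem FSmoothAt.dir {h : M → ℝ} {x : M} {W : VField n M} (hh : FSmoothAt (n := n) h x)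
    (hW : VSmoothAt W x) : FSmoothAt (n := n) (fun y ↦ dir h (W y)) x := by
  have A := ContMDiffAt.mfderiv_const (m := ∞) hh (by norm_cast)
  have B := ContMDiffAt.clm_apply_of_inCoordinates A hW hh
  rw [contMDiffAt_totalSpace] at B
  have B' := B.2
  simp only [trivializationAt_model_space_apply] at B'
  exact B'

/-- A function written in the preferred chart at `x`. -/
def inChart (n : ℕ) {M : Type*} [TopologicalSpace M] [ChartedSpace (EuclideanSpace ℝ (Fin n)) M]
    (x : M) (h : M → ℝ) : EuclideanSpace ℝ (Fin n) → ℝ := h ∘ (extChartAt (𝓡 n) x).symm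

theorem dir_eq_fderiv {h : M → ℝ} {x : M} (hh : FDiffAt (n := n) h x) (v : Tan n x) :
    dir h v = fderiv ℝ (inChart n x h) (extChartAt (𝓡 n) x x) v := by
  rw [dir, hh.mvfderiv]
  simp [inChart, writtenInExtChartAt]
  rfl

/-- The tangent space at `x` is the model space read through the preferred chart at `x`, so the
change of coordinates involved is trivial. This is special to the centre of the chart. -/
theorem mfderiv_extChartAt_eq_id (x : M) :
    mfderiv (𝓡 n) 𝓘(ℝ, EuclideanSpace ℝ (Fin n)) (extChartAt (𝓡 n) x) x
      = ContinuousLinearMap.id ℝ (EuclideanSpace ℝ (Fin n)) := by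
  rw [(hasMFDerivAt_extChartAt (I := 𝓡 n) (mem_chart_source _ x)).mfderiv,
    mfderiv_chartAt_eq_tangentCoordChange (mem_chart_source _ x)]
  ext1 v
  exact tangentCoordChange_self (mem_extChartAt_source x)

theorem mfderiv_extChartAt_symm_eq_id (x : M) :
    mfderivWithin 𝓘(ℝ, EuclideanSpace ℝ (Fin n)) (𝓡 n) (extChartAt (𝓡 n) x).symm
      (Set.range (𝓡 n)) (extChartAt (𝓡 n) x x)
      = ContinuousLinearMap.id ℝ (EuclideanSpace ℝ (Fin n)) := by
  have h := mfderiv_extChartAt_comp_mfderivWithin_extChartAt_symm' (I := 𝓡 n)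
    (mem_extChartAt_source (I := 𝓡 n) x)
  rw [mfderiv_extChartAt_eq_id] at h
  exact h

/-- A vector field written in the preferred chart at `x`. -/
def fieldInChart (x : M) (V : VField n M) : EuclideanSpace ℝ (Fin n) → EuclideanSpace ℝ (Fin n) :=
  mpullbackWithin 𝓘(ℝ, EuclideanSpace ℝ (Fin n)) (𝓡 n) (extChartAt (𝓡 n) x).symm V
    (Set.range (𝓡 n))

theorem fieldInChart_self (x : M) (V : VField n M) :
    fieldInChart x V (extChartAt (𝓡 n) x x) = V x := by
  rw [fieldInChart, mpullbackWithin_apply, mfderiv_extChartAt_symm_eq_id, extChartAt_to_inv]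
  exact DFunLike.congr_fun (ContinuousLinearMap.inverse_id (R := ℝ)
    (M := EuclideanSpace ℝ (Fin n))) (V x)

theorem range_inter_univ (x : M) :
    ((extChartAt (𝓡 n) x).symm ⁻¹' Set.univ ∩ Set.range (𝓡 n)) = Set.univ := by simp

theorem VDiffAt.fieldInChart {V : VField n M} {x : M} (hV : VDiffAt V x) :
    DifferentiableAt ℝ (fieldInChart x V) (extChartAt (𝓡 n) x x) := by
  have h := (mdifferentiableWithinAt_univ.2 hV).differentiableWithinAt_mpullbackWithin_vectorField
  rw [range_inter_univ] at h
  exact differentiableWithinAt_univ.1 h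

theorem FSmoothAt.inChart {h : M → ℝ} {x : M} (hh : FSmoothAt (n := n) h x) :
    ContDiffAt ℝ ∞ (inChart n x h) (extChartAt (𝓡 n) x x) := by
  have := (contMDiffAt_iff.1 hh).2
  rwa [show Set.range (𝓡 n) = Set.univ by simp, contDiffWithinAt_univ] at this

theorem mlieBracket_eq (x : M) (V W : VField n M) :
    mlieBracket (𝓡 n) V W x
      = lieBracket ℝ (fieldInChart x V) (fieldInChart x W) (extChartAt (𝓡 n) x x) := by
  rw [← mlieBracketWithin_univ, mlieBracketWithin_apply, range_inter_univ,
    mfderiv_extChartAt_eq_id]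
  refine (DFunLike.congr_fun (ContinuousLinearMap.inverse_id (R := ℝ)
    (M := EuclideanSpace ℝ (Fin n))) _).trans ?_
  rw [← lieBracketWithin_univ]
  rfl

/-- Needed near the point and not only at it, since the expression is differentiated once more. The
differential of the chart is invertible there, so pushing the pulled-back field forward returns `V`.
-/
theorem dir_symm_eventually {h : M → ℝ} {x : M} (hh : FSmoothAt (n := n) h x) (V : VField n M) :
    inChart n x (fun y ↦ dir h (V y)) =ᶠ[𝓝 (extChartAt (𝓡 n) x x)]
      fun z ↦ fderiv ℝ (inChart n x h) z (fieldInChart x V z) := by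
  have hc : ContinuousAt (extChartAt (𝓡 n) x).symm (extChartAt (𝓡 n) x x) :=
    continuousAt_extChartAt_symm x
  have h1 := hc.eventually (p := fun y ↦ FDiffAt (n := n) h y)
    (by rw [extChartAt_to_inv]; exact hh.eventually_diff)
  filter_upwards [h1, extChartAt_target_mem_nhds (I := 𝓡 n) x] with z hz hzt
  have hi := isInvertible_mfderivWithin_extChartAt_symm (I := 𝓡 n) hzt
  have hd := mdifferentiableWithinAt_extChartAt_symm (I := 𝓡 n) hzt
  have hr : Set.range (𝓡 n) = Set.univ := by simp
  rw [hr] at hi hd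
  rw [mdifferentiableWithinAt_univ] at hd
  rw [← mfderiv_eq_fderiv]
  have hcomp := mfderiv_comp_apply (I := 𝓘(ℝ, EuclideanSpace ℝ (Fin n))) (I' := 𝓡 n)
    (I'' := 𝓘(ℝ, ℝ)) (g := h) z hz hd (fieldInChart x V z)
  refine Eq.trans ?_ hcomp.symm
  have hV : mfderiv 𝓘(ℝ, EuclideanSpace ℝ (Fin n)) (𝓡 n) (extChartAt (𝓡 n) x).symm z
      (fieldInChart x V z) = V ((extChartAt (𝓡 n) x).symm z) := by
    rw [fieldInChart, mpullbackWithin_apply, hr, ← mfderivWithin_univ]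
    exact hi.self_apply_inverse _
  rw [hV]
  rfl

/-- In the chart, V(W h) = D²h(V, W) + Dh(DW·V); the second derivative is symmetric, so only the
bracket survives antisymmetrization. -/
theorem dir_mlieBracket {h : M → ℝ} {x : M} {V W : VField n M} (hh : FSmoothAt (n := n) h x)
    (hV : VSmoothAt V x) (hW : VSmoothAt W x) :
    dir h (mlieBracket (𝓡 n) V W x)
      = dir (fun y ↦ dir h (W y)) (V x) - dir (fun y ↦ dir h (V y)) (W x) := by
  have hc := hh.inChart
  have key {V W : VField n M} (hW : VSmoothAt W x) :
      dir (fun y ↦ dir h (W y)) (V x)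
      = fderiv ℝ (fderiv ℝ (inChart n x h)) (extChartAt (𝓡 n) x x) (V x) (W x)
        + fderiv ℝ (inChart n x h) (extChartAt (𝓡 n) x x)
          (fderiv ℝ (fieldInChart x W) (extChartAt (𝓡 n) x x) (V x)) := by
    rw [dir_eq_fderiv (hh.dir hW).diff, (dir_symm_eventually hh W).fderiv_eq]
    have h2 : DifferentiableAt ℝ (fderiv ℝ (inChart n x h)) (extChartAt (𝓡 n) x x) :=
      (hc.fderiv_right (m := 1) (by norm_cast)).differentiableAt (by simp)
    have := h2.hasFDerivAt.clm_apply hW.diff.fieldInChart.hasFDerivAt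
    rw [this.fderiv]
    rw [fieldInChart_self]
    exact add_comm (G := ℝ) _ _
  rw [key hW, key hV, dir_eq_fderiv hh.diff, mlieBracket_eq, lieBracket_eq]
  have hs : IsSymmSndFDerivAt ℝ (inChart n x h) (extChartAt (𝓡 n) x x) :=
    hc.isSymmSndFDerivAt (by simp; norm_cast)
  have := hs.eq (V x) (W x)
  simp only [fieldInChart_self]
  erw [map_sub]
  erw [this]
  ring

/-- The function is `α` applied to the chart coordinates centred at `x`. Smoothness on a whole
neighbourhood is recorded because the Bianchi identity uses the symmetry of its Hessian near `x`. -/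
theorem exists_function_dir (x : M) (α : Tan n x →ₗ[ℝ] ℝ) :
    ∃ h : M → ℝ, (∀ᶠ y in 𝓝 x, FSmoothAt (n := n) h y) ∧ h x = 0 ∧
      ∀ u : Tan n x, dir h u = α u := by
  let β : EuclideanSpace ℝ (Fin n) →L[ℝ] ℝ :=
    LinearMap.toContinuousLinearMap (E := EuclideanSpace ℝ (Fin n)) α
  have hs : ∀ᶠ y in 𝓝 x,
      FSmoothAt (n := n) (fun y ↦ β (extChartAt (𝓡 n) x y - extChartAt (𝓡 n) x x)) y := by
    filter_upwards [chart_source_mem_nhds (EuclideanSpace ℝ (Fin n)) x] with y hy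
    have h1 : ContMDiffAt (𝓡 n) 𝓘(ℝ, EuclideanSpace ℝ (Fin n)) ∞
        (fun y ↦ extChartAt (𝓡 n) x y - extChartAt (𝓡 n) x x) y :=
      (contMDiffAt_extChartAt' hy).sub contMDiffAt_const
    exact β.contMDiff.contMDiffAt.comp y h1
  refine ⟨_, hs, by simp, fun u ↦ ?_⟩
  rw [dir_eq_fderiv hs.self_of_nhds.diff]
  have : inChart n x (fun y ↦ β (extChartAt (𝓡 n) x y - extChartAt (𝓡 n) x x))
      =ᶠ[𝓝 (extChartAt (𝓡 n) x x)] fun z ↦ β (z - extChartAt (𝓡 n) x x) := by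
    filter_upwards [extChartAt_target_mem_nhds (I := 𝓡 n) x] with z hz
    simp only [inChart, Function.comp_apply]
    rw [(extChartAt (𝓡 n) x).right_inv hz]
  rw [this.fderiv_eq]
  simp only [map_sub]
  exact DFunLike.congr_fun (β.hasFDerivAt.sub_const (β (extChartAt (𝓡 n) x x))).fderiv u

end Bochner

end

/-! ### Tensor fields, and independence of the covariant derivative from the extending fields. -/

noncomputable section

namespace Bochner

attribute [local instance] isManifold_two isManifold_three

variable {n : ℕ} {M : Type*} [TopologicalSpace M] [ChartedSpace (EuclideanSpace ℝ (Fin n)) M]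
  [IsManifold (𝓡 n) ∞ M]

/-- Multilinearity of a function of `k` vectors. -/
def IsMulti {E : Type*} [AddCommGroup E] [Module ℝ E] {k : ℕ} (t : (Fin k → E) → ℝ) : Prop :=
  ∃ m : MultilinearMap ℝ (fun _ : Fin k ↦ E) ℝ, ∀ v, t v = m v

section IsMulti

variable {E : Type*} [AddCommGroup E] [Module ℝ E] {k : ℕ} {t : (Fin k → E) → ℝ}

theorem IsMulti.map_add (ht : IsMulti t) (v : Fin k → E) (s : Fin k) (a b : E) :
    t (Function.update v s (a + b)) = t (Function.update v s a) + t (Function.update v s b) := by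
  obtain ⟨m, hm⟩ := ht
  simp [hm]

theorem IsMulti.map_smul (ht : IsMulti t) (v : Fin k → E) (s : Fin k) (c : ℝ) (a : E) :
    t (Function.update v s (c • a)) = c * t (Function.update v s a) := by
  obtain ⟨m, hm⟩ := ht
  simp [hm]

theorem IsMulti.mk (h₁ : ∀ v s a b,
      t (Function.update v s (a + b)) = t (Function.update v s a) + t (Function.update v s b))
    (h₂ : ∀ v s (c : ℝ) a, t (Function.update v s (c • a)) = c * t (Function.update v s a)) :
    IsMulti t :=
  ⟨{ toFun := t
     map_update_add' := by
      intro _ v s a b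
      convert h₁ v s a b
     map_update_smul' := by
      intro _ v s c a
      rw [smul_eq_mul]
      convert h₂ v s c a }, fun _ ↦ rfl⟩

theorem update_eval {ι X : Type*} [DecidableEq ι] {E : X → Type*} (W : ι → (x : X) → E x) (s : ι)
    (σ : (x : X) → E x) (y : X) :
    (fun r ↦ Function.update W s σ r y) = Function.update (fun r ↦ W r y) s (σ y) := by
  funext r
  by_cases h : r = s
  · subst h; simp
  · simp [h]

end IsMulti

/-- A tensor field which is multilinear near `x` and maps differentiable vector fields to
differentiable functions. -/
structure TDiffAt {k : ℕ} (T : Tensor n M k) (x : M) : Prop where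
  multi : ∀ᶠ y in 𝓝 x, IsMulti (T y)
  diff : ∀ V : Fin k → VField n M, (∀ s, VDiffAt (V s) x) →
    FDiffAt (n := n) (fun y ↦ T y fun s ↦ V s y) x

/-- A tensor field which is multilinear near `x` and maps smooth vector fields to
smooth functions. -/
structure TSmoothAt {k : ℕ} (T : Tensor n M k) (x : M) : Prop where
  multi : ∀ᶠ y in 𝓝 x, IsMulti (T y)
  smooth : ∀ V : Fin k → VField n M, (∀ s, VSmoothAt (V s) x) →
    FSmoothAt (n := n) (fun y ↦ T y fun s ↦ V s y) x

theorem FDiffAt.prod {ι : Type*} (s : Finset ι) {F : ι → M → ℝ} {x : M}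
    (hF : ∀ i ∈ s, FDiffAt (n := n) (F i) x) : FDiffAt (n := n) (fun y ↦ ∏ i ∈ s, F i y) x := by
  classical
  induction s using Finset.induction_on with
  | empty => simpa using mdifferentiableAt_const
  | insert a s ha ih =>
    simp only [Finset.prod_insert ha]
    exact (hF a (Finset.mem_insert_self a s)).mul
      (ih fun i hi ↦ hF i (Finset.mem_insert_of_mem hi))

/-- `TSmoothAt` tests on fields smooth at `x` only. A field merely differentiable at a nearby point
is expanded in a smooth local frame; by multilinearity finitely many functions T(E_I), all smooth at
`x`, control everything. -/
theorem TSmoothAt.eventually_diff {k : ℕ} {T : Tensor n M k} {x : M} (hT : TSmoothAt T x) :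
    ∀ᶠ y in 𝓝 x, TDiffAt T y := by
  let t := trivializationAt (EuclideanSpace ℝ (Fin n)) (TangentSpace (𝓡 n) : M → Type _) x
  have hx : x ∈ t.baseSet := FiberBundle.mem_baseSet_trivializationAt _ _ x
  let b := (EuclideanSpace.basisFun (Fin n) ℝ).toBasis
  let E := t.localFrame b
  let c := t.localFrameCoeff (𝓡 n) b
  have hI : ∀ᶠ y in 𝓝 x, ∀ I : Fin k → Fin n,
      FDiffAt (n := n) (fun z ↦ T z fun s ↦ E (I s) z) y :=
    Filter.eventually_all.2 fun I ↦ (hT.smooth (fun s ↦ E (I s)) fun s ↦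
      contMDiffAt_localFrame_of_mem ∞ t b (I s) hx).eventually_diff
  filter_upwards [hI, hT.multi.eventually_nhds, t.open_baseSet.mem_nhds hx] with y hy hm hyt
  refine ⟨hm, fun V hV ↦ ?_⟩
  have hc (s i) : FDiffAt (n := n) (fun z ↦ c i z (V s z)) y :=
    mdifferentiableAt_localFrameCoeff b hyt (hV s) i
  have hsum : FDiffAt (n := n) (fun z ↦ ∑ I : Fin k → Fin n,
      (∏ s, c (I s) z (V s z)) * T z fun s ↦ E (I s) z) y :=
    -- Only the differentiability half of `dir_sum` is used, so the direction is set to 0.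
    (dir_sum Finset.univ (fun I _ ↦ (FDiffAt.prod Finset.univ fun s _ ↦ hc s (I s)).mul (hy I))
      0).1
  refine hsum.congr_of_eventuallyEq ?_
  filter_upwards [hm, t.open_baseSet.mem_nhds hyt] with z hz hzt
  obtain ⟨m, hm⟩ := hz
  have hV' (s) : V s z = ∑ i, c i z (V s z) • E i z := t.eq_sum_localFrameCoeff_smul hzt
  simp only [hm]
  conv_lhs => rw [funext hV']
  rw [MultilinearMap.map_sum]
  simp only [MultilinearMap.map_smul_univ, smul_eq_mul]

theorem TSmoothAt.diff {k : ℕ} {T : Tensor n M k} {x : M} (hT : TSmoothAt T x) : TDiffAt T x :=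
  hT.eventually_diff.self_of_nhds

variable [RiemannianBundle (fun x : M ↦ TangentSpace (𝓡 n) x)]
    [IsContMDiffRiemannianBundle (𝓡 n) ∞ (EuclideanSpace ℝ (Fin n))
      (fun x : M ↦ TangentSpace (𝓡 n) x)]

/-- The covariant derivative of `T` in the direction `u`, computed with the vector fields `V`. -/
def covFields {k : ℕ} (T : Tensor n M k) {x : M} (V : Fin k → VField n M) (u : Tan n x) : ℝ :=
  dir (fun y ↦ T y fun s ↦ V s y) u
    - ∑ s : Fin k, T x (Function.update (fun r ↦ V r x) s (nabla (V s) u))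

variable {k : ℕ} {T : Tensor n M k} {x : M}

theorem update_diff {W : Fin k → VField n M} (hW : ∀ s, VDiffAt (W s) x) (s : Fin k)
    {σ : VField n M} (hσ : VDiffAt σ x) (r : Fin k) : VDiffAt (Function.update W s σ r) x := by
  by_cases h : r = s
  · subst h; simpa using hσ
  · simpa [h] using hW r

/-- Isolates the dependence on the field in slot `s`: derivatives of σ occur in the first two terms
only, the remaining sum sees just σ x. -/
theorem covFields_update (W : Fin k → VField n M) (s : Fin k) (σ : VField n M)
    (u : Tan n x) :
    covFields T (Function.update W s σ) u
      = dir (fun y ↦ T y (Function.update (fun r ↦ W r y) s (σ y))) u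
        - T x (Function.update (fun r ↦ W r x) s (nabla σ u))
        - ∑ r ∈ Finset.univ.erase s, T x (Function.update
            (Function.update (fun r ↦ W r x) r (nabla (W r) u)) s (σ x)) := by
  unfold covFields
  simp only [update_eval]
  rw [← Finset.add_sum_erase _ _ (Finset.mem_univ s)]
  simp only [Function.update_self, Function.update_idem]
  rw [sub_sub]
  congr 2
  refine Finset.sum_congr rfl fun r hr ↦ ?_
  have hr' : r ≠ s := Finset.ne_of_mem_erase hr
  rw [Function.update_of_ne hr', Function.update_comm hr'.symm]

/-- The term (u f) T(…, σ, …) from the product rule cancels the one that the Leibniz rule for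
`nabla` puts into slot `s`. -/
theorem covFields_tensorial (hT : TDiffAt T x) {W : Fin k → VField n M}
    (hW : ∀ s, VDiffAt (W s) x) (s : Fin k) (u : Tan n x) :
    TensorialAt (𝓡 n) (EuclideanSpace ℝ (Fin n))
      (fun σ ↦ covFields T (Function.update W s σ) u) x where
  smul {f σ} hf hσ := by
    have hm := hT.multi.self_of_nhds
    have hd := hT.diff _ (update_diff hW s hσ)
    simp only [update_eval] at hd
    simp only [covFields_update, Pi.smul_apply', nabla_smul hf hσ, hm.map_add, hm.map_smul]
    rw [dir_congr (h := fun y ↦ f y * T y (Function.update (fun r ↦ W r y) s (σ y)))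
      (hT.multi.mono fun y hy ↦ hy.map_smul _ _ _ _), dir_mul hf hd, ← Finset.mul_sum,
      smul_eq_mul]
    ring
  add {σ σ'} hσ hσ' := by
    have hm := hT.multi.self_of_nhds
    have hd := hT.diff _ (update_diff hW s hσ)
    have hd' := hT.diff _ (update_diff hW s hσ')
    simp only [update_eval] at hd hd'
    simp only [covFields_update, Pi.add_apply, nabla_add hσ hσ', hm.map_add]
    rw [dir_congr (h := fun y ↦ T y (Function.update (fun r ↦ W r y) s (σ y))
        + T y (Function.update (fun r ↦ W r y) s (σ' y)))
      (hT.multi.mono fun y hy ↦ hy.map_add _ _ _ _), dir_add hd hd', Finset.sum_add_distrib]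
    ring

theorem covFields_congr (hT : TDiffAt T x) {V W : Fin k → VField n M}
    (hV : ∀ s, VDiffAt (V s) x) (hW : ∀ s, VDiffAt (W s) x) (h : ∀ s, V s x = W s x)
    (u : Tan n x) : covFields T V u = covFields T W u := by
  classical
  -- The fields are exchanged one slot at a time, each exchange being tensoriality in that slot.
  suffices H : ∀ S : Finset (Fin k), covFields T (S.piecewise V W) u = covFields T W u by
    simpa using H Finset.univ
  intro S
  induction S using Finset.induction_on with
  | empty => simp
  | insert j S hj ih =>
    rw [← ih, Finset.piecewise_insert]
    have hP (s) : VDiffAt (S.piecewise V W s) x := by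
      by_cases hs : s ∈ S
      · rw [Finset.piecewise_eq_of_mem _ _ _ hs]; exact hV s
      · rw [Finset.piecewise_eq_of_notMem _ _ _ hs]; exact hW s
    have := (covFields_tensorial hT hP j u).pointwise (hV j) (hP j)
      (by rw [Finset.piecewise_eq_of_notMem _ _ _ hj]; exact h j)
    simpa using this

theorem covDeriv_eq (hT : TDiffAt T x) {V : Fin k → VField n M} (hV : ∀ s, VDiffAt (V s) x)
    (u : Tan n x) {v : Fin (k + 1) → Tan n x} (hv : ∀ s : Fin k, v s.castSucc = V s x)
    (hu : v (Fin.last k) = u) : covDeriv T x v = covFields T V u := by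
  rw [covFields_congr hT hV (fun s ↦ ext_diff (v s.castSucc)) fun s ↦ by rw [ext_self, hv]]
  simp only [covDeriv, covFields, ext_self, hu]

end Bochner

end

/-! ### Fields and orthonormal frames parallel at a point. -/

noncomputable section

namespace Bochner

attribute [local instance] isManifold_two isManifold_three

variable {n : ℕ} {M : Type*} [TopologicalSpace M] [ChartedSpace (EuclideanSpace ℝ (Fin n)) M]
  [IsManifold (𝓡 n) ∞ M] [RiemannianBundle (fun x : M ↦ TangentSpace (𝓡 n) x)]
    [IsContMDiffRiemannianBundle (𝓡 n) ∞ (EuclideanSpace ℝ (Fin n))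
      (fun x : M ↦ TangentSpace (𝓡 n) x)]

/-- A vector field smooth at `x`, whose covariant derivative vanishes at `x`. -/
def ParallelAt (V : VField n M) (x : M) : Prop :=
  VSmoothAt V x ∧ ∀ u : Tan n x, nabla V u = 0

/-- A function smooth at `x`, whose differential vanishes at `x`. -/
def StationaryAt (n : ℕ) {M : Type*} [TopologicalSpace M]
    [ChartedSpace (EuclideanSpace ℝ (Fin n)) M] (h : M → ℝ) (x : M) : Prop :=
  FSmoothAt (n := n) h x ∧ ∀ u : Tan n x, dir h u = 0

section closure

variable {V W : VField n M} {g h : M → ℝ} {x : M}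

theorem VSmoothAt.add (hV : VSmoothAt V x) (hW : VSmoothAt W x) : VSmoothAt (V + W) x :=
  ContMDiffAt.add_section hV hW

theorem VSmoothAt.smul (hh : FSmoothAt (n := n) h x) (hV : VSmoothAt V x) :
    VSmoothAt (h • V) x :=
  ContMDiffAt.smul_section hh hV

theorem VSmoothAt.sum {ι : Type*} (s : Finset ι) {F : ι → VField n M}
    (hF : ∀ i ∈ s, VSmoothAt (F i) x) : VSmoothAt (fun y ↦ ∑ i ∈ s, F i y) x :=
  ContMDiffAt.sum_section hF

theorem ParallelAt.add (hV : ParallelAt V x) (hW : ParallelAt W x) : ParallelAt (V + W) x :=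
  ⟨hV.1.add hW.1, fun u ↦ by rw [nabla_add hV.1.diff hW.1.diff, hV.2, hW.2, add_zero]⟩

theorem ParallelAt.smul (hh : StationaryAt n h x) (hV : ParallelAt V x) : ParallelAt (h • V) x :=
  ⟨VSmoothAt.smul hh.1 hV.1, fun u ↦ by
    rw [nabla_smul hh.1.diff hV.1.diff, hV.2, hh.2, smul_zero, zero_smul, add_zero]⟩

theorem ParallelAt.zero : ParallelAt (0 : VField n M) x := by
  have h0 : VSmoothAt (0 : VField n M) x := by
    have := VSmoothAt.smul (h := fun _ : M ↦ (0 : ℝ)) contMDiffAt_const (ext_smooth (0 : Tan n x))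
    have e0 : ((fun _ : M ↦ (0 : ℝ)) • ext (0 : Tan n x) : VField n M) = 0 := by
      funext y; exact zero_smul ℝ (ext (0 : Tan n x) y)
    rwa [e0] at this
  refine ⟨h0, fun u ↦ ?_⟩
  have := nabla_add h0.diff h0.diff u
  rw [add_zero] at this
  simpa using this

theorem ParallelAt.sum {ι : Type*} (s : Finset ι) {F : ι → VField n M}
    (hF : ∀ i ∈ s, ParallelAt (F i) x) : ParallelAt (∑ i ∈ s, F i) x := by
  classical
  induction s using Finset.induction_on with
  | empty => simpa using ParallelAt.zero
  | insert a s ha ih =>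
    rw [Finset.sum_insert ha]
    exact (hF a (Finset.mem_insert_self a s)).add
      (ih fun i hi ↦ hF i (Finset.mem_insert_of_mem hi))

theorem ParallelAt.inner (hV : ParallelAt V x) (hW : ParallelAt W x) :
    StationaryAt n (fun y ↦ inner ℝ (V y) (W y)) x :=
  ⟨hV.1.inner hW.1, fun u ↦ by simp [dir_inner hV.1.diff hW.1.diff, hV.2, hW.2]⟩

theorem StationaryAt.mul (hg : StationaryAt n g x) (hh : StationaryAt n h x) :
    StationaryAt n (fun y ↦ g y * h y) x :=
  ⟨hg.1.mul hh.1, fun u ↦ by simp [dir_mul hg.1.diff hh.1.diff, hg.2, hh.2]⟩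

theorem StationaryAt.comp {ρ : ℝ → ℝ} (hρ : ContDiffAt ℝ ∞ ρ (h x)) (hh : StationaryAt n h x) :
    StationaryAt n (fun y ↦ ρ (h y)) x := by
  refine ⟨hρ.contMDiffAt.comp x hh.1, fun u ↦ ?_⟩
  have h1 : MDifferentiableAt 𝓘(ℝ, ℝ) 𝓘(ℝ, ℝ) ρ (h x) :=
    hρ.contMDiffAt.mdifferentiableAt (by simp)
  have h2 := mfderiv_comp_apply (I'' := 𝓘(ℝ, ℝ)) x h1 hh.1.diff u
  refine Eq.trans h2 ?_
  have h3 : mfderiv (𝓡 n) 𝓘(ℝ, ℝ) h x u = 0 := hh.2 u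
  rw [h3]
  exact map_zero _

end closure

/-- Vectors extend to vector fields which are parallel at the given point. -/
theorem exists_parallelAt {x : M} (v : Tan n x) : ∃ V : VField n M, ParallelAt V x ∧ V x = v := by
  -- With h_j(x) = 0 and dh_j = α_j, the field h_j e_j vanishes at `x` and has covariant derivative
  -- α_j(u) e_j there; summed over j, this cancels the derivative of `ext v` without changing its
  -- value.
  let α (j : Fin n) : Tan n x →ₗ[ℝ] ℝ :=
    { toFun := fun u ↦ -inner ℝ (onb x j) (nabla (ext v) u)
      map_add' := fun a b ↦ by rw [nabla_add_right (ext_diff v), inner_add_right]; ring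
      map_smul' := fun c a ↦ by
        rw [nabla_smul_right (ext_diff v), real_inner_smul_right]; simp }
  choose h hs' h0 hd using fun j ↦ exists_function_dir x (α j)
  have hs (j) := (hs' j).self_of_nhds
  let W (j : Fin n) : VField n M := h j • ext (onb x j)
  have hW (j) : VSmoothAt (W j) x := VSmoothAt.smul (hs j) (ext_smooth _)
  have hWn (j) (u : Tan n x) : nabla (W j) u = α j u • onb x j := by
    rw [nabla_smul (hs j).diff (ext_diff _), h0, hd, zero_smul, zero_add, ext_self]
  have hsum (s : Finset (Fin n)) : VSmoothAt (∑ j ∈ s, W j) x ∧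
      ∀ u : Tan n x, nabla (∑ j ∈ s, W j) u = ∑ j ∈ s, α j u • onb x j := by
    induction s using Finset.induction_on with
    | empty => exact ⟨ParallelAt.zero.1, fun u ↦ ParallelAt.zero.2 u⟩
    | insert a s ha ih =>
      rw [Finset.sum_insert ha]
      refine ⟨(hW a).add ih.1, fun u ↦ ?_⟩
      rw [nabla_add (hW a).diff ih.1.diff, ih.2, hWn, Finset.sum_insert ha]
  refine ⟨ext v + ∑ j, W j, ⟨(ext_smooth v).add (hsum _).1, fun u ↦ ?_⟩, ?_⟩
  · rw [nabla_add (ext_diff v) (hsum _).1.diff, (hsum _).2]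
    conv_lhs => rw [← (onb x).sum_repr' (nabla (ext v) u)]
    simp [α]
  · simp [W, h0, ext_self]

/-- Orthonormal bases extend to local orthonormal frames which are parallel at the given point. -/
theorem exists_parallel_frame {x : M} (e : OrthonormalBasis (Fin n) ℝ (Tan n x)) :
    ∃ E : Fin n → VField n M, (∀ i, ParallelAt (E i) x) ∧ (∀ i, E i x = e i) ∧
      ∀ᶠ y in 𝓝 x, ∃ b : OrthonormalBasis (Fin n) ℝ (Tan n y), ∀ i, b i = E i y := by
  choose F hF hFx using fun i ↦ exists_parallelAt (e i)
  -- Pointwise Gram–Schmidt preserves parallelism at `x`: its coefficients are built from inner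
  -- products of fields parallel at `x`, hence are stationary there. At `x` itself it changes
  -- nothing, as `e` is orthonormal.
  let G (i : Fin n) : VField n M := fun y ↦ InnerProductSpace.gramSchmidt ℝ (fun j ↦ F j y) i
  have hGx (i) : G i x = e i := by
    have : InnerProductSpace.gramSchmidt ℝ e = e :=
      InnerProductSpace.gramSchmidt_of_orthogonal ℝ fun i j hij ↦ e.orthonormal.2 hij
    simp only [G, hFx]
    exact congrFun this i
  have hGi (i) : inner ℝ (G i x) (G i x) = 1 := by
    rw [hGx, real_inner_self_eq_norm_sq, e.orthonormal.1 i, one_pow]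
  have hG (i) : ParallelAt (G i) x := by
    induction i using WellFoundedLT.induction with
    | ind i ih =>
      have hc (j) (hj : j ∈ Finset.Iio i) : ParallelAt
          ((fun y ↦ (-1) * (inner ℝ (G j y) (F i y) * (inner ℝ (G j y) (G j y))⁻¹)) • G j) x := by
        have hGj := ih j (Finset.mem_Iio.1 hj)
        refine ParallelAt.smul (.mul ⟨contMDiffAt_const, fun u ↦ dir_const _ u⟩
          (.mul (hGj.inner (hF i)) (.comp (ρ := fun t ↦ t⁻¹) ?_ (hGj.inner hGj)))) hGj
        exact contDiffAt_inv ℝ (by rw [hGi]; exact one_ne_zero)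
      have := (hF i).add (ParallelAt.sum _ hc)
      convert this using 1
      funext y
      simp only [G, Pi.add_apply, Finset.sum_apply, Pi.smul_apply']
      conv_lhs => rw [InnerProductSpace.gramSchmidt_def]
      rw [sub_eq_add_neg, ← Finset.sum_neg_distrib]
      congr 1
      refine Finset.sum_congr rfl fun j _ ↦ ?_
      rw [Submodule.starProjection_singleton, ← neg_smul, real_inner_self_eq_norm_sq]
      congr 1
      simp [div_eq_mul_inv]
  let N (i : Fin n) : VField n M :=
    (fun y ↦ (Real.sqrt (inner ℝ (G i y) (G i y)))⁻¹) • G i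
  have hN (i) : ParallelAt (N i) x := by
    refine ParallelAt.smul ?_ (hG i)
    refine StationaryAt.comp (ρ := fun t ↦ (Real.sqrt t)⁻¹) ?_ ((hG i).inner (hG i))
    rw [hGi]
    exact (Real.contDiffAt_sqrt one_ne_zero).inv (by simp)
  refine ⟨N, hN, fun i ↦ by simp [N, hGx], ?_⟩
  -- The square norms equal 1 at `x`, so by continuity they stay positive nearby and normalization
  -- makes sense.
  have hpos : ∀ᶠ y in 𝓝 x, ∀ i, 0 < inner ℝ (G i y) (G i y) := by
    refine Filter.eventually_all.2 fun i ↦ ?_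
    refine ((hG i).inner (hG i)).1.continuousAt.eventually (lt_mem_nhds ?_)
    exact lt_of_lt_of_eq one_pos (hGi i).symm
  filter_upwards [hpos] with y hy
  have hon : Orthonormal ℝ fun i ↦ N i y := by
    constructor
    · intro i
      simp only [N, Pi.smul_apply', norm_smul]
      rw [real_inner_self_eq_norm_sq, Real.sqrt_sq (norm_nonneg _), norm_inv, norm_norm]
      refine inv_mul_cancel₀ fun h ↦ ?_
      have := hy i
      rw [real_inner_self_eq_norm_sq, h] at this
      simp at this
    · intro i j hij
      simp only [N, Pi.smul_apply', real_inner_smul_left, real_inner_smul_right]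
      rw [show inner ℝ (G i y) (G j y) = 0 from InnerProductSpace.gramSchmidt_orthogonal ℝ _ hij]
      simp
  have : FiniteDimensional ℝ (Tan n y) :=
    inferInstanceAs (FiniteDimensional ℝ (EuclideanSpace ℝ (Fin n)))
  have hc : Fintype.card (Fin n) = Module.finrank ℝ (Tan n y) :=
    (Fintype.card_fin n).trans (finrank_euclideanSpace_fin (𝕜 := ℝ) (n := n)).symm
  exact ⟨OrthonormalBasis.mk hon (hon.linearIndependent.span_eq_top_of_card_eq_finrank' hc).ge,
    fun i ↦ congrFun (OrthonormalBasis.coe_mk ..) i⟩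

/-- In an orthonormal frame smooth at `x`, the components of `W` are its inner products with the
frame. -/
theorem vSmoothAt_of_inner {W : VField n M} {x : M}
    (h : ∀ Z : VField n M, VSmoothAt Z x → FSmoothAt (n := n) (fun y ↦ inner ℝ (Z y) (W y)) x) :
    VSmoothAt W x := by
  obtain ⟨E, hE, -, hb⟩ := exists_parallel_frame (onb (n := n) x)
  have hs : VSmoothAt (fun y ↦ ∑ i, ((fun y ↦ inner ℝ (E i y) (W y)) • E i) y) x :=
    VSmoothAt.sum _ fun i _ ↦ VSmoothAt.smul (h _ (hE i).1) (hE i).1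
  refine hs.congr_of_eventuallyEq ?_
  filter_upwards [hb] with y ⟨b, hb⟩
  simp only [Pi.smul_apply', ← hb, b.sum_repr']

theorem VSmoothAt.mlieBracket {X Y : VField n M} {x : M} (hX : VSmoothAt X x)
    (hY : VSmoothAt Y x) : VSmoothAt (mlieBracket (𝓡 n) X Y) x := by
  have : IsManifold (𝓡 n) (((⊤ : ℕ∞) : WithTop ℕ∞) + 1) M := by simpa using ‹IsManifold (𝓡 n) ∞ M›
  exact ContMDiffAt.mlieBracket_vectorField (m := ⊤) (n := ⊤) hX hY (by simp)

/-- Tested against a smooth `Z`, the field is the Koszul expression, whose six terms are visibly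
smooth. -/
theorem VSmoothAt.nabla {X Y : VField n M} {x : M} (hX : VSmoothAt X x) (hY : VSmoothAt Y x) :
    VSmoothAt (fun y ↦ nabla Y (X y)) x := by
  refine vSmoothAt_of_inner fun Z hZ ↦ ?_
  have hk : FSmoothAt (n := n) (fun y ↦ koszul X Y Z y) x := by
    refine contMDiffAt_const.mul (ContMDiffAt.sub (ContMDiffAt.sub (ContMDiffAt.add
      (ContMDiffAt.sub (ContMDiffAt.add ?_ ?_) ?_) ?_) ?_) ?_)
    · exact (hY.inner hZ).dir hX
    · exact (hX.inner hZ).dir hY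
    · exact (hX.inner hY).dir hZ
    · exact (hX.mlieBracket hY).inner hZ
    · exact (hX.mlieBracket hZ).inner hY
    · exact (hY.mlieBracket hZ).inner hX
  refine hk.congr_of_eventuallyEq ?_
  filter_upwards [hX.eventually_diff, hY.eventually_diff, hZ.eventually_diff] with y h1 h2 h3
  rw [real_inner_comm, nabla_inner h1 h2 h3]

/-! ### The covariant derivative of a smooth tensor field is a smooth tensor field. -/

section covDeriv

variable {k : ℕ} {T : Tensor n M k} {x : M}

/-- Exhibits the dependence on one tensor slot as a linear map; multilinearity of the covariant
derivative follows. -/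
theorem covDeriv_update_castSucc (hT : TDiffAt T x) (v : Fin (k + 1) → Tan n x) (s : Fin k)
    (a : Tan n x) :
    covDeriv T x (Function.update v s.castSucc a) = TensorialAt.mkHom _ x
      (covFields_tensorial hT (fun r ↦ ext_diff (v r.castSucc)) s (v (Fin.last k))) a := by
  rw [TensorialAt.mkHom_apply_eq_extend]
  refine covDeriv_eq hT (update_diff (fun r ↦ ext_diff (v r.castSucc)) s (ext_diff a)) _
    (fun r ↦ ?_) (Function.update_of_ne (Fin.castSucc_lt_last s).ne' _ _)
  by_cases h : r = s
  · subst h; simp [ext_self]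
  · rw [Function.update_of_ne (by simpa using h), Function.update_of_ne h, ext_self]

theorem covDeriv_update_last (v : Fin (k + 1) → Tan n x) (a : Tan n x) :
    covDeriv T x (Function.update v (Fin.last k) a)
      = covFields T (fun s ↦ ext (v s.castSucc)) a := by
  have h (s : Fin k) : Function.update v (Fin.last k) a s.castSucc = v s.castSucc :=
    Function.update_of_ne (Fin.castSucc_lt_last s).ne _ _
  simp only [covDeriv, covFields, h, ext_self, Function.update_self]

theorem TDiffAt.covDeriv_multi (hT : TDiffAt T x) : IsMulti (covDeriv T x) := by
  have hm := hT.multi.self_of_nhds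
  refine IsMulti.mk (fun v s a b ↦ ?_) fun v s c a ↦ ?_
  · refine Fin.lastCases ?_ (fun s ↦ ?_) s
    · simp only [covDeriv_update_last, covFields, dir_add_right, nabla_add_right (ext_diff _),
        hm.map_add, Finset.sum_add_distrib]
      ring
    · simp only [covDeriv_update_castSucc hT, map_add]
  · refine Fin.lastCases ?_ (fun s ↦ ?_) s
    · simp only [covDeriv_update_last, covFields, dir_smul_right, nabla_smul_right (ext_diff _),
        hm.map_smul, ← Finset.mul_sum]
      ring
    · simp only [covDeriv_update_castSucc hT, map_smul, smul_eq_mul]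

theorem FSmoothAt.sum {ι : Type*} (s : Finset ι) {F : ι → M → ℝ} {x : M}
    (hF : ∀ i ∈ s, FSmoothAt (n := n) (F i) x) :
    FSmoothAt (n := n) (fun y ↦ ∑ i ∈ s, F i y) x := by
  exact contMDiffAt_finsetSum hF

/-- The definition uses extensions `ext` that change with the base point, with no control on how.
Near `x` the given fields `V` can be used instead at every point, and then each term is smooth. -/
theorem TSmoothAt.covDeriv (hT : TSmoothAt T x) : TSmoothAt (covDeriv T) x := by
  refine ⟨hT.eventually_diff.mono fun y hy ↦ hy.covDeriv_multi, fun V hV ↦ ?_⟩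
  let W (s : Fin k) : VField n M := fun y ↦ Bochner.nabla (V s.castSucc) (V (Fin.last k) y)
  have hW (s) : VSmoothAt (W s) x := (hV _).nabla (hV _)
  have h1 : FSmoothAt (n := n) (fun y ↦ dir (fun z ↦ T z fun s ↦ V s.castSucc z)
      (V (Fin.last k) y)) x := (hT.smooth _ fun s ↦ hV s.castSucc).dir (hV _)
  have h2 (s : Fin k) : FSmoothAt (n := n)
      (fun y ↦ T y (Function.update (fun r ↦ V r.castSucc y) s (W s y))) x := by
    have := hT.smooth (Function.update (fun r ↦ V r.castSucc) s (W s)) fun r ↦ by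
      by_cases h : r = s
      · subst h; simpa using hW r
      · simpa [h] using hV r.castSucc
    simpa only [update_eval] using this
  refine (h1.sub (FSmoothAt.sum Finset.univ fun s _ ↦ h2 s)).congr_of_eventuallyEq ?_
  have hd : ∀ᶠ y in 𝓝 x, ∀ s : Fin k, VDiffAt (V s.castSucc) y :=
    Filter.eventually_all.2 fun s ↦ (hV _).eventually_diff
  filter_upwards [hT.eventually_diff, hd] with y hy hd
  exact covDeriv_eq hy hd _ (fun _ ↦ rfl) rfl

end covDeriv

section lowRank

variable {x : M} {A B C : VField n M}

theorem covDeriv_one {T : Tensor n M 1} (hT : TDiffAt T x) (hA : VDiffAt A x) (u : Tan n x) :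
    covDeriv T x ![A x, u] = dir (fun y ↦ T y ![A y]) u - T x ![nabla A u] := by
  rw [covDeriv_eq hT (V := ![A]) (u := u) (by simpa using hA) (by simp) (by simp [Fin.last])]
  have e (y : M) : (fun s : Fin 1 ↦ (![A] : Fin 1 → VField n M) s y) = ![A y] := by
    funext s; fin_cases s; rfl
  have e0 (w : Tan n x) : Function.update ![A x] 0 w = ![w] := by
    funext s; fin_cases s; rfl
  simp only [covFields, e, Fin.sum_univ_one, e0]
  rfl

theorem covDeriv_two {T : Tensor n M 2} (hT : TDiffAt T x) (hA : VDiffAt A x) (hB : VDiffAt B x)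
    (u : Tan n x) :
    covDeriv T x ![A x, B x, u] = dir (fun y ↦ T y ![A y, B y]) u - T x ![nabla A u, B x]
      - T x ![A x, nabla B u] := by
  rw [covDeriv_eq hT (V := ![A, B]) (u := u) (Fin.forall_fin_two.2 ⟨hA, hB⟩)
    (Fin.forall_fin_two.2 ⟨rfl, rfl⟩) rfl]
  have e (y : M) : (fun s : Fin 2 ↦ (![A, B] : Fin 2 → VField n M) s y) = ![A y, B y] := by
    funext s; fin_cases s <;> rfl
  have e0 (w : Tan n x) : Function.update ![A x, B x] 0 w = ![w, B x] := by
    funext s; fin_cases s <;> rfl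
  have e1 (w : Tan n x) : Function.update ![A x, B x] 1 w = ![A x, w] := by
    funext s; fin_cases s <;> rfl
  simp only [covFields, e, Fin.sum_univ_two, e0, e1, sub_sub]
  rfl

theorem covDeriv_three {T : Tensor n M 3} (hT : TDiffAt T x) (hA : VDiffAt A x)
    (hB : VDiffAt B x) (hC : VDiffAt C x) (u : Tan n x) :
    covDeriv T x ![A x, B x, C x, u] = dir (fun y ↦ T y ![A y, B y, C y]) u
      - T x ![nabla A u, B x, C x] - T x ![A x, nabla B u, C x] - T x ![A x, B x, nabla C u] := by
  rw [covDeriv_eq hT (V := ![A, B, C]) (u := u)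
    (Fin.forall_fin_succ.2 ⟨hA, Fin.forall_fin_two.2 ⟨hB, hC⟩⟩)
    (Fin.forall_fin_succ.2 ⟨rfl, Fin.forall_fin_two.2 ⟨rfl, rfl⟩⟩) rfl]
  have e (y : M) : (fun s : Fin 3 ↦ (![A, B, C] : Fin 3 → VField n M) s y)
      = ![A y, B y, C y] := by
    funext s; fin_cases s <;> rfl
  have e0 (w : Tan n x) : Function.update ![A x, B x, C x] 0 w = ![w, B x, C x] := by
    funext s; fin_cases s <;> rfl
  have e1 (w : Tan n x) : Function.update ![A x, B x, C x] 1 w = ![A x, w, C x] := by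
    funext s; fin_cases s <;> rfl
  have e2 (w : Tan n x) : Function.update ![A x, B x, C x] 2 w = ![A x, B x, w] := by
    funext s; fin_cases s <;> rfl
  simp only [covFields, e, Fin.sum_univ_three, e0, e1, e2, sub_sub, add_assoc]
  rfl

end lowRank

/-! ### Second covariant derivatives, curvature and the Ricci identities. -/

section IsMulti

variable {E : Type*} [AddCommGroup E] [Module ℝ E]

theorem IsMulti.one_add {t : (Fin 1 → E) → ℝ} (ht : IsMulti t) (a b : E) :
    t ![a + b] = t ![a] + t ![b] := by
  have e (w : E) : Function.update ![0] 0 w = ![w] := by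
    funext s; fin_cases s; rfl
  simpa only [e] using ht.map_add ![0] 0 a b

theorem IsMulti.one_smul {t : (Fin 1 → E) → ℝ} (ht : IsMulti t) (c : ℝ) (a : E) :
    t ![c • a] = c * t ![a] := by
  have e (w : E) : Function.update ![0] 0 w = ![w] := by
    funext s; fin_cases s; rfl
  simpa only [e] using ht.map_smul ![0] 0 c a

theorem IsMulti.one_sub {t : (Fin 1 → E) → ℝ} (ht : IsMulti t) (a b : E) :
    t ![a - b] = t ![a] - t ![b] := by
  rw [sub_eq_add_neg, ht.one_add, ← neg_one_smul ℝ b, ht.one_smul]; ring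

theorem IsMulti.two_sub_left {t : (Fin 2 → E) → ℝ} (ht : IsMulti t) (a b c : E) :
    t ![a - b, c] = t ![a, c] - t ![b, c] := by
  have e (w : E) : Function.update ![0, c] 0 w = ![w, c] := by
    funext s; fin_cases s <;> rfl
  rw [← e a, ← e b, ← e (a - b), sub_eq_add_neg, ht.map_add, ← neg_one_smul ℝ b, ht.map_smul]
  ring

theorem IsMulti.two_sub_right {t : (Fin 2 → E) → ℝ} (ht : IsMulti t) (a b c : E) :
    t ![c, a - b] = t ![c, a] - t ![c, b] := by
  have e (w : E) : Function.update ![c, 0] 1 w = ![c, w] := by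
    funext s; fin_cases s <;> rfl
  rw [← e a, ← e b, ← e (a - b), sub_eq_add_neg, ht.map_add, ← neg_one_smul ℝ b, ht.map_smul]
  ring

/-- A multilinear function vanishes when one of its variables does. -/
theorem IsMulti.map_zero {k : ℕ} {t : (Fin k → E) → ℝ} (ht : IsMulti t) {v : Fin k → E}
    (s : Fin k) (hv : v s = 0) : t v = 0 := by
  have := ht.map_smul v s 0 0
  rwa [zero_smul, zero_mul, ← hv, Function.update_eq_self] at this

end IsMulti

/-- The curvature `∇_W ∇_U V - ∇_U ∇_W V + ∇_{[U, W]} V`, computed with vector fields. -/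
def curvFields (U W V : VField n M) (x : M) : Tan n x :=
  nabla (fun y ↦ nabla V (U y)) (W x) - nabla (fun y ↦ nabla V (W y)) (U x)
    + nabla V (mlieBracket (𝓡 n) U W x)

theorem TSmoothAt.smooth_one {x : M} {T : Tensor n M 1} (hT : TSmoothAt T x) {A : VField n M}
    (hA : VSmoothAt A x) : FSmoothAt (n := n) (fun y ↦ T y ![A y]) x := by
  have e (y : M) : (fun s : Fin 1 ↦ (![A] : Fin 1 → VField n M) s y) = ![A y] := by
    funext s; fin_cases s; rfl
  simpa only [e] using hT.smooth ![A] (by simpa using hA)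

theorem TSmoothAt.smooth_two {x : M} {T : Tensor n M 2} (hT : TSmoothAt T x) {A B : VField n M}
    (hA : VSmoothAt A x) (hB : VSmoothAt B x) : FSmoothAt (n := n) (fun y ↦ T y ![A y, B y]) x := by
  have e (y : M) : (fun s : Fin 2 ↦ (![A, B] : Fin 2 → VField n M) s y) = ![A y, B y] := by
    funext s; fin_cases s <;> rfl
  simpa only [e] using hT.smooth ![A, B] (Fin.forall_fin_two.2 ⟨hA, hB⟩)

theorem TSmoothAt.smooth_three {x : M} {T : Tensor n M 3} (hT : TSmoothAt T x)
    {A B C : VField n M} (hA : VSmoothAt A x) (hB : VSmoothAt B x) (hC : VSmoothAt C x) :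
    FSmoothAt (n := n) (fun y ↦ T y ![A y, B y, C y]) x := by
  have e (y : M) : (fun s : Fin 3 ↦ (![A, B, C] : Fin 3 → VField n M) s y)
      = ![A y, B y, C y] := by
    funext s; fin_cases s <;> rfl
  simpa only [e] using hT.smooth ![A, B, C]
    (Fin.forall_fin_succ.2 ⟨hA, Fin.forall_fin_two.2 ⟨hB, hC⟩⟩)

variable {x : M}

/-- The fields are arbitrary, not parallel at `x`, because the tensoriality of the curvature is to
be deduced from this expansion. -/
theorem covDeriv_covDeriv_one {T : Tensor n M 1} (hT : TSmoothAt T x) {U V W : VField n M}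
    (hU : VSmoothAt U x) (hV : VSmoothAt V x) (hW : VSmoothAt W x) :
    covDeriv (covDeriv T) x ![V x, U x, W x]
      = dir (fun y ↦ dir (fun z ↦ T z ![V z]) (U y)) (W x)
        - dir (fun y ↦ T y ![nabla V (U y)]) (W x)
        - (dir (fun y ↦ T y ![nabla V (W y)]) (U x)
          - T x ![nabla (fun y ↦ nabla V (W y)) (U x)])
        - (dir (fun y ↦ T y ![V y]) (nabla U (W x)) - T x ![nabla V (nabla U (W x))]) := by
  rw [covDeriv_two hT.covDeriv.diff hV.diff hU.diff,
    covDeriv_one hT.diff hV.diff, covDeriv_one hT.diff (A := fun y ↦ nabla V (W y))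
      (hW.nabla hV).diff,
    dir_congr (h := fun y ↦ dir (fun z ↦ T z ![V z]) (U y) - T y ![nabla V (U y)]), dir_sub]
  · exact ((hT.smooth_one hV).dir hU).diff
  · exact (hT.smooth_one (hU.nabla hV)).diff
  · filter_upwards [hT.eventually_diff, hV.eventually_diff] with y h1 h2
    exact covDeriv_one h1 h2 _

/-- The Ricci identity for 1-tensors. -/
theorem ricci_one_fields {T : Tensor n M 1} (hT : TSmoothAt T x) {U V W : VField n M}
    (hU : VSmoothAt U x) (hV : VSmoothAt V x) (hW : VSmoothAt W x) :
    covDeriv (covDeriv T) x ![V x, U x, W x] - covDeriv (covDeriv T) x ![V x, W x, U x]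
      = -T x ![curvFields U W V x] := by
  rw [covDeriv_covDeriv_one hT hU hV hW, covDeriv_covDeriv_one hT hW hV hU]
  have hm := hT.multi.self_of_nhds
  -- The iterated derivatives of T(V) differ by a derivative along the bracket; vanishing torsion
  -- writes the bracket through `nabla`, which matches the first-order terms of the two expansions.
  have h1 := dir_mlieBracket (hT.smooth_one hV) hU hW
  rw [curvFields, hm.one_add, hm.one_sub]
  rw [← nabla_sub_nabla hU.diff hW.diff] at h1 ⊢
  rw [dir_sub_right] at h1
  rw [sub_eq_add_neg (nabla W (U x)), nabla_add_right hV.diff, ← neg_one_smul ℝ (nabla U (W x)),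
    nabla_smul_right hV.diff, hm.one_add, hm.one_smul]
  linarith

/-- The 1-tensor field dual to a vector field. -/
def flat (Z : VField n M) : Tensor n M 1 := fun y v ↦ inner ℝ (Z y) (v 0)

theorem flat_smooth {Z : VField n M} (hZ : VSmoothAt Z x) : TSmoothAt (flat Z) x := by
  refine ⟨.of_forall fun y ↦ IsMulti.mk (fun v s a b ↦ ?_) fun v s c a ↦ ?_, fun V hV ↦ ?_⟩
  · rw [Subsingleton.elim s 0]; simp [flat, inner_add_right]
  · rw [Subsingleton.elim s 0]; simp [flat, real_inner_smul_right]
  · exact hZ.inner (hV 0)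

/-- The left side of the Ricci identity depends only on the values of the fields at `x`, hence so
does the right side; applied to the dual of an arbitrary vector, this is the tensoriality of
curvature. -/
theorem curvFields_eq {U V W : VField n M} (hU : VSmoothAt U x) (hV : VSmoothAt V x)
    (hW : VSmoothAt W x) : curvFields U W V x = Rm (U x) (W x) (V x) := by
  refine ext_inner_left ℝ fun z ↦ ?_
  have h1 := ricci_one_fields (flat_smooth (ext_smooth z)) hU hV hW
  have h2 := ricci_one_fields (flat_smooth (ext_smooth z)) (ext_smooth (U x)) (ext_smooth (V x))
    (ext_smooth (W x))
  simp only [ext_self] at h2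
  rw [h1] at h2
  simp only [flat, ext_self, curvFields] at h2
  simpa [curvFields, Rm] using h2

theorem ricci_one {T : Tensor n M 1} (hT : TSmoothAt T x) (u v w : Tan n x) :
    covDeriv (covDeriv T) x ![v, u, w] - covDeriv (covDeriv T) x ![v, w, u] = -T x ![Rm u w v] := by
  have h := ricci_one_fields hT (ext_smooth u) (ext_smooth v) (ext_smooth w)
  rw [curvFields_eq (ext_smooth u) (ext_smooth v) (ext_smooth w)] at h
  simpa only [ext_self] using h

theorem Rm_eq_of_parallel {U V W : VField n M} (hU : ParallelAt U x) (hV : ParallelAt V x)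
    (hW : ParallelAt W x) : Rm (U x) (W x) (V x)
      = nabla (fun y ↦ nabla V (U y)) (W x) - nabla (fun y ↦ nabla V (W y)) (U x) := by
  rw [← curvFields_eq hU.1 hV.1 hW.1, curvFields, hV.2, add_zero]

theorem mlieBracket_eq_zero_of_parallel {U W : VField n M} (hU : ParallelAt U x)
    (hW : ParallelAt W x) : mlieBracket (𝓡 n) U W x = 0 := by
  rw [← nabla_sub_nabla hU.1.diff hW.1.diff, hU.2, hW.2, sub_zero]

theorem covDeriv_covDeriv_two {T : Tensor n M 2} (hT : TSmoothAt T x) {A B U W : VField n M}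
    (hA : ParallelAt A x) (hB : ParallelAt B x) (hU : ParallelAt U x) :
    covDeriv (covDeriv T) x ![A x, B x, U x, W x]
      = dir (fun y ↦ dir (fun z ↦ T z ![A z, B z]) (U y)) (W x)
        - T x ![nabla (fun y ↦ nabla A (U y)) (W x), B x]
        - T x ![A x, nabla (fun y ↦ nabla B (U y)) (W x)] := by
  have hm := hT.covDeriv.multi.self_of_nhds
  have hm0 := hT.multi.self_of_nhds
  have hA' := hU.1.nabla hA.1
  have hB' := hU.1.nabla hB.1
  -- ∇_U A vanishes at `x`, but its derivative need not: the derivative of T(∇_U A, B) along W is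
  -- T(∇_W ∇_U A, B).
  have e1 := covDeriv_two hT.diff hA'.diff hB.1.diff (W x)
  have e2 := covDeriv_two hT.diff hA.1.diff hB'.diff (W x)
  rw [hm.map_zero 0 (by simp [hA.2]), hB.2, hm0.map_zero (v := ![_, 0]) 1 rfl] at e1
  rw [hm.map_zero 1 (by simp [hB.2]), hA.2, hm0.map_zero (v := ![0, _]) 0 rfl] at e2
  rw [covDeriv_three hT.covDeriv.diff hA.1.diff hB.1.diff hU.1.diff, hA.2, hB.2, hU.2,
    hm.map_zero (v := ![0, _, _]) 0 rfl, hm.map_zero (v := ![_, 0, _]) 1 rfl,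
    hm.map_zero (v := ![_, _, 0]) 2 rfl,
    dir_congr (h := fun y ↦ dir (fun z ↦ T z ![A z, B z]) (U y) - T y ![nabla A (U y), B y]
      - T y ![A y, nabla B (U y)]), dir_sub, dir_sub]
  · linarith
  · exact ((hT.smooth_two hA.1 hB.1).dir hU.1).diff
  · exact (hT.smooth_two hA' hB.1).diff
  · exact FSmoothAt.diff (((hT.smooth_two hA.1 hB.1).dir hU.1).sub (hT.smooth_two hA' hB.1))
  · exact (hT.smooth_two hA.1 hB').diff
  · filter_upwards [hT.eventually_diff, hA.1.eventually_diff, hB.1.eventually_diff] with y h h1 h2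
    exact covDeriv_two h h1 h2 _

/-- The Ricci identity for 2-tensors. -/
theorem ricci_two {T : Tensor n M 2} (hT : TSmoothAt T x) (a b u w : Tan n x) :
    covDeriv (covDeriv T) x ![a, b, u, w] - covDeriv (covDeriv T) x ![a, b, w, u]
      = -T x ![Rm u w a, b] - T x ![a, Rm u w b] := by
  -- With fields parallel at `x` the bracket of U and W vanishes there, so derivatives of T(A, B)
  -- commute and only the curvature terms remain.
  obtain ⟨A, hA, rfl⟩ := exists_parallelAt a
  obtain ⟨B, hB, rfl⟩ := exists_parallelAt b
  obtain ⟨U, hU, rfl⟩ := exists_parallelAt u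
  obtain ⟨W, hW, rfl⟩ := exists_parallelAt w
  have hm := hT.multi.self_of_nhds
  have hd := dir_mlieBracket (hT.smooth_two hA.1 hB.1) hU.1 hW.1
  rw [mlieBracket_eq_zero_of_parallel hU hW, show dir (fun y ↦ T y ![A y, B y]) (0 : Tan n x) = 0
    from map_zero _] at hd
  rw [covDeriv_covDeriv_two hT hA hB hU, covDeriv_covDeriv_two hT hA hB hW,
    Rm_eq_of_parallel hU hA hW, Rm_eq_of_parallel hU hB hW]
  rw [hm.two_sub_left, hm.two_sub_right]
  linarith

theorem covDeriv_zero {k : ℕ} : covDeriv (fun _ _ ↦ 0 : Tensor n M k) = fun _ _ ↦ 0 := by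
  funext y v
  simp [covDeriv, dir_const]

section parallel

variable {A B C : VField n M}

theorem covDeriv_one_parallel {T : Tensor n M 1} (hT : TDiffAt T x) (hA : ParallelAt A x)
    (u : Tan n x) : covDeriv T x ![A x, u] = dir (fun y ↦ T y ![A y]) u := by
  rw [covDeriv_one hT hA.1.diff, hA.2, hT.multi.self_of_nhds.map_zero (v := ![0]) 0 rfl, sub_zero]

theorem covDeriv_two_parallel {T : Tensor n M 2} (hT : TDiffAt T x) (hA : ParallelAt A x)
    (hB : ParallelAt B x) (u : Tan n x) :
    covDeriv T x ![A x, B x, u] = dir (fun y ↦ T y ![A y, B y]) u := by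
  have hm := hT.multi.self_of_nhds
  rw [covDeriv_two hT hA.1.diff hB.1.diff, hA.2, hB.2, hm.map_zero (v := ![0, _]) 0 rfl,
    hm.map_zero (v := ![_, 0]) 1 rfl, sub_zero, sub_zero]

theorem covDeriv_three_parallel {T : Tensor n M 3} (hT : TDiffAt T x) (hA : ParallelAt A x)
    (hB : ParallelAt B x) (hC : ParallelAt C x) (u : Tan n x) :
    covDeriv T x ![A x, B x, C x, u] = dir (fun y ↦ T y ![A y, B y, C y]) u := by
  have hm := hT.multi.self_of_nhds
  rw [covDeriv_three hT hA.1.diff hB.1.diff hC.1.diff, hA.2, hB.2, hC.2,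
    hm.map_zero (v := ![0, _, _]) 0 rfl, hm.map_zero (v := ![_, 0, _]) 1 rfl,
    hm.map_zero (v := ![_, _, 0]) 2 rfl, sub_zero, sub_zero, sub_zero]

theorem covDeriv_symm_two {T : Tensor n M 2} (hT : TDiffAt T x)
    (hs : ∀ᶠ y in 𝓝 x, ∀ u v, T y ![u, v] = T y ![v, u]) (a b u : Tan n x) :
    covDeriv T x ![a, b, u] = covDeriv T x ![b, a, u] := by
  obtain ⟨A, hA, rfl⟩ := exists_parallelAt a
  obtain ⟨B, hB, rfl⟩ := exists_parallelAt b
  rw [covDeriv_two_parallel hT hA hB, covDeriv_two_parallel hT hB hA]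
  exact dir_congr (hs.mono fun y hy ↦ hy _ _) u

theorem covDeriv_symm_three {T : Tensor n M 3} (hT : TDiffAt T x)
    (hs : ∀ᶠ y in 𝓝 x, ∀ u v w, T y ![u, v, w] = T y ![v, u, w]) (a b c u : Tan n x) :
    covDeriv T x ![a, b, c, u] = covDeriv T x ![b, a, c, u] := by
  obtain ⟨A, hA, rfl⟩ := exists_parallelAt a
  obtain ⟨B, hB, rfl⟩ := exists_parallelAt b
  obtain ⟨C, hC, rfl⟩ := exists_parallelAt c
  rw [covDeriv_three_parallel hT hA hB hC, covDeriv_three_parallel hT hB hA hC]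
  exact dir_congr (hs.mono fun y hy ↦ hy _ _ _) u

end parallel

/-! ### Symmetries of the Hessian and of the curvature tensor. -/

section hess

variable {f : M → ℝ}

theorem diff_apply (f : M → ℝ) (v : Fin 1 → Tan n x) : diff n f x v = dir f (v 0) := by
  simp [diff, covDeriv, Fin.last]

theorem diff_smooth (hf : FSmoothAt (n := n) f x) : TSmoothAt (diff n f) x :=
  TSmoothAt.covDeriv (k := 0) ⟨.of_forall fun _ ↦
    IsMulti.mk (fun _ s ↦ s.elim0) fun _ s ↦ s.elim0, fun _ _ ↦ hf⟩

theorem hess_smooth (hf : FSmoothAt (n := n) f x) : TSmoothAt (hess n f) x :=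
  (diff_smooth hf).covDeriv

theorem hess_symm (hf : FSmoothAt (n := n) f x) (u v : Tan n x) :
    hess n f x ![u, v] = hess n f x ![v, u] := by
  obtain ⟨U, hU, rfl⟩ := exists_parallelAt u
  obtain ⟨V, hV, rfl⟩ := exists_parallelAt v
  have h := dir_mlieBracket hf hU.1 hV.1
  rw [mlieBracket_eq_zero_of_parallel hU hV, show dir f (0 : Tan n x) = 0 from map_zero _] at h
  rw [hess, covDeriv_one_parallel (diff_smooth hf).diff hU,
    covDeriv_one_parallel (diff_smooth hf).diff hV]
  simp only [diff_apply, Matrix.cons_val_zero]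
  linarith

theorem covDeriv_hess_symm (hf : ∀ᶠ y in 𝓝 x, FSmoothAt (n := n) f y) (a b u : Tan n x) :
    covDeriv (hess n f) x ![a, b, u] = covDeriv (hess n f) x ![b, a, u] :=
  covDeriv_symm_two (hess_smooth hf.self_of_nhds).diff (hf.mono fun _ hy ↦ hess_symm hy) a b u

end hess

section riem

/-- The left side of the Ricci identity is antisymmetric in the two directions of differentiation.
-/
theorem Rm_swap (u w v : Tan n x) : Rm u w v = -Rm w u v := by
  refine ext_inner_left ℝ fun z ↦ ?_
  have h1 := ricci_one (flat_smooth (ext_smooth z)) u v w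
  have h2 := ricci_one (flat_smooth (ext_smooth z)) w v u
  simp only [flat, ext_self, Matrix.cons_val_zero] at h1 h2
  rw [inner_neg_right]
  linarith

theorem riem_swap_left (a b c d : Tan n x) : riem a b c d = -riem b a c d := by
  rw [riem, Rm_swap, inner_neg_left, riem]

variable (n M) in
/-- The metric as a 2-tensor field. -/
def metricTensor : Tensor n M 2 := fun _ v ↦ inner ℝ (v 0) (v 1)

theorem metricTensor_smooth (x : M) : TSmoothAt (metricTensor n M) x := by
  refine ⟨.of_forall fun y ↦ IsMulti.mk (fun v s a b ↦ ?_) fun v s c a ↦ ?_, fun V hV ↦ ?_⟩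
  · fin_cases s <;> simp [metricTensor, inner_add_right, inner_add_left]
  · fin_cases s <;> simp [metricTensor, real_inner_smul_right, real_inner_smul_left]
  · exact (hV 0).inner (hV 1)

theorem covDeriv_metricTensor : covDeriv (metricTensor n M) = fun _ _ ↦ 0 := by
  funext y v
  have e : v = ![ext (v 0) y, ext (v 1) y, v 2] := by
    funext s; fin_cases s <;> simp [ext_self]
  rw [e, covDeriv_two (metricTensor_smooth y).diff (ext_diff _) (ext_diff _)]
  simp only [metricTensor, Matrix.cons_val_zero, Matrix.cons_val_one]
  rw [dir_inner (ext_diff _) (ext_diff _)]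
  ring

/-- The Ricci identity for the metric, whose covariant derivative is zero. -/
theorem riem_swap_right (a b c d : Tan n x) : riem a b c d = -riem a b d c := by
  have h := ricci_two (metricTensor_smooth x) c d a b
  rw [covDeriv_metricTensor, covDeriv_zero] at h
  simp only [metricTensor, Matrix.cons_val_zero, Matrix.cons_val_one] at h
  rw [riem, riem, real_inner_comm c]
  linarith

/-- The first Bianchi identity. -/
theorem riem_bianchi (a b c d : Tan n x) : riem a b c d + riem b c a d + riem c a b d = 0 := by
  -- For dh = ⟨d, ·⟩ at `x`, the cyclic sum of the Ricci identities for dh has the required right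
  -- side, and the third derivatives cancel because the Hessian is symmetric near `x`.
  obtain ⟨h, hs, -, hd⟩ := exists_function_dir x (innerₗ (Tan n x) d)
  have hT := diff_smooth hs.self_of_nhds
  have h1 := ricci_one hT a c b
  have h2 := ricci_one hT b a c
  have h3 := ricci_one hT c b a
  have s1 := covDeriv_hess_symm hs a b c
  have s2 := covDeriv_hess_symm hs b c a
  have s3 := covDeriv_hess_symm hs c a b
  simp only [hess] at s1 s2 s3
  simp only [diff_apply, hd, Matrix.cons_val_zero, innerₗ_apply_apply] at h1 h2 h3
  simp only [riem, real_inner_comm d]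
  linarith

/-- The classical combination of the four Bianchi identities obtained by rotating the arguments,
with the two antisymmetries. -/
theorem riem_pair (a b c d : Tan n x) : riem a b c d = riem c d a b := by
  have h1 := riem_bianchi a b c d
  have h2 := riem_bianchi b c d a
  have h3 := riem_bianchi c d a b
  have h4 := riem_bianchi d a b c
  have l := @riem_swap_left n M _ _ _ _ _ x
  have r := @riem_swap_right n M _ _ _ _ _ x
  linarith [l b c a d, l c a b d, r b c a d, r c a b d, r a b c d, r b c d a, r c d b a,
    r d b c a, r c d a b, r d a c b, r a c d b, r d a b c, r a b d c, r b d a c, l d b c a,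
    l b d a c, l b d c a, l a c d b, r a c b d, l a c b d, l d b a c, r d b a c]

theorem riem_linear_four (a b c : Tan n x) : IsLinearMap ℝ (riem a b c) :=
  ⟨fun _ _ ↦ inner_add_right _ _ _, fun _ _ ↦ real_inner_smul_right _ _ _⟩

/-- Only the last slot is linear by definition; the symmetries carry linearity to the others. -/
theorem riem_linear_three (a b d : Tan n x) : IsLinearMap ℝ fun c ↦ riem a b c d := by
  simp only [riem_swap_right a b _ d]
  exact ⟨fun u v ↦ by rw [(riem_linear_four a b d).map_add, neg_add],
    fun r u ↦ by rw [(riem_linear_four a b d).map_smul, smul_neg]⟩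

theorem riem_linear_two (a c d : Tan n x) : IsLinearMap ℝ fun b ↦ riem a b c d := by
  simp only [riem_pair a _ c d]
  exact riem_linear_four c d a

theorem riem_linear_one (b c d : Tan n x) : IsLinearMap ℝ fun a ↦ riem a b c d := by
  simp only [riem_pair _ b c d]
  exact riem_linear_three c d b

end riem

theorem toTensor_smooth {φ : (x : M) → Tan n x →L[ℝ] Tan n x →L[ℝ] ℝ}
    (hφ : ContMDiffAt (𝓡 n)
      ((𝓡 n).prod 𝓘(ℝ, EuclideanSpace ℝ (Fin n) →L[ℝ] EuclideanSpace ℝ (Fin n) →L[ℝ] ℝ)) ∞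
      (fun x ↦ TotalSpace.mk' (EuclideanSpace ℝ (Fin n) →L[ℝ] EuclideanSpace ℝ (Fin n) →L[ℝ] ℝ)
        (E := fun x : M ↦ TangentSpace (𝓡 n) x →L[ℝ] TangentSpace (𝓡 n) x →L[ℝ] ℝ) x (φ x)) x) :
    TSmoothAt (toTensor φ) x := by
  refine ⟨.of_forall fun y ↦ IsMulti.mk (fun v s a b ↦ ?_) fun v s c a ↦ ?_, fun V hV ↦ ?_⟩
  · fin_cases s <;> simp [toTensor]
  · fin_cases s <;> simp [toTensor]
  · have h := ContMDiffAt.clm_bundle_apply₂ (F₁ := EuclideanSpace ℝ (Fin n))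
      (F₂ := EuclideanSpace ℝ (Fin n)) (F₃ := ℝ) (E₃ := Bundle.Trivial M ℝ) hφ (hV 0) (hV 1)
    simp only [contMDiffAt_totalSpace] at h
    exact h.2

/-! ### Traces and their independence of the orthonormal basis. -/

section traces

variable {E : Type*} [AddCommGroup E] [Module ℝ E]

/-- Separate linearity in two variables. -/
def IsBilin (B : E → E → ℝ) : Prop :=
  (∀ v, IsLinearMap ℝ fun u ↦ B u v) ∧ ∀ u, IsLinearMap ℝ fun v ↦ B u v

theorem IsMulti.linear {k : ℕ} {t : (Fin k → E) → ℝ} (ht : IsMulti t) (v : Fin k → E)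
    (s : Fin k) : IsLinearMap ℝ fun u ↦ t (Function.update v s u) :=
  ⟨ht.map_add v s, ht.map_smul v s⟩

theorem IsMulti.linear_one {t : (Fin 1 → E) → ℝ} (ht : IsMulti t) :
    IsLinearMap ℝ fun u ↦ t ![u] := by
  have e (w : E) : Function.update ![0] 0 w = ![w] := by funext s; fin_cases s; rfl
  simpa only [e] using ht.linear ![0] 0

theorem IsMulti.of_linear_one {t : (Fin 1 → E) → ℝ} (h : IsLinearMap ℝ fun u ↦ t ![u]) :
    IsMulti t := by
  have e (v : Fin 1 → E) (w : E) : Function.update v 0 w = ![w] := by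
    funext s; fin_cases s; rfl
  refine IsMulti.mk (fun v s a b ↦ ?_) fun v s c a ↦ ?_ <;> rw [Subsingleton.elim s 0]
  · simp only [e]; exact h.map_add a b
  · simp only [e]; exact h.map_smul c a

theorem IsMulti.linear_two_fst {t : (Fin 2 → E) → ℝ} (ht : IsMulti t) (b : E) :
    IsLinearMap ℝ fun u ↦ t ![u, b] := by
  have e (w : E) : Function.update ![0, b] 0 w = ![w, b] := by funext s; fin_cases s <;> rfl
  simpa only [e] using ht.linear ![0, b] 0

theorem IsMulti.linear_two_snd {t : (Fin 2 → E) → ℝ} (ht : IsMulti t) (a : E) :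
    IsLinearMap ℝ fun u ↦ t ![a, u] := by
  have e (w : E) : Function.update ![a, 0] 1 w = ![a, w] := by funext s; fin_cases s <;> rfl
  simpa only [e] using ht.linear ![a, 0] 1

theorem IsMulti.linear_three_fst {t : (Fin 3 → E) → ℝ} (ht : IsMulti t) (b c : E) :
    IsLinearMap ℝ fun u ↦ t ![u, b, c] := by
  have e (w : E) : Function.update ![0, b, c] 0 w = ![w, b, c] := by
    funext s; fin_cases s <;> rfl
  simpa only [e] using ht.linear ![0, b, c] 0

theorem IsMulti.linear_three_snd {t : (Fin 3 → E) → ℝ} (ht : IsMulti t) (a c : E) :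
    IsLinearMap ℝ fun u ↦ t ![a, u, c] := by
  have e (w : E) : Function.update ![a, 0, c] 1 w = ![a, w, c] := by
    funext s; fin_cases s <;> rfl
  simpa only [e] using ht.linear ![a, 0, c] 1

theorem IsMulti.linear_three_trd {t : (Fin 3 → E) → ℝ} (ht : IsMulti t) (a b : E) :
    IsLinearMap ℝ fun u ↦ t ![a, b, u] := by
  have e (w : E) : Function.update ![a, b, 0] 2 w = ![a, b, w] := by
    funext s; fin_cases s <;> rfl
  simpa only [e] using ht.linear ![a, b, 0] 2

theorem IsMulti.bilin_two {t : (Fin 2 → E) → ℝ} (ht : IsMulti t) :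
    IsBilin fun u v ↦ t ![u, v] :=
  ⟨ht.linear_two_fst, ht.linear_two_snd⟩

variable {g h : E → ℝ}

theorem isLinearMap_const_mul (c : ℝ) (hg : IsLinearMap ℝ g) : IsLinearMap ℝ fun u ↦ c * g u :=
  ⟨fun u v ↦ by rw [hg.map_add, mul_add],
    fun r u ↦ by rw [hg.map_smul, smul_eq_mul, smul_eq_mul]; ring⟩

theorem isLinearMap_mul_const (hg : IsLinearMap ℝ g) (c : ℝ) : IsLinearMap ℝ fun u ↦ g u * c := by
  simpa only [mul_comm] using isLinearMap_const_mul c hg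

theorem isLinearMap_sub (hg : IsLinearMap ℝ g) (hh : IsLinearMap ℝ h) :
    IsLinearMap ℝ fun u ↦ g u - h u :=
  ⟨fun u v ↦ by rw [hg.map_add, hh.map_add]; ring,
    fun r u ↦ by rw [hg.map_smul, hh.map_smul, smul_sub]⟩

theorem isLinearMap_sum {ι : Type*} (s : Finset ι) {F : ι → E → ℝ}
    (hF : ∀ i, IsLinearMap ℝ (F i)) : IsLinearMap ℝ fun u ↦ ∑ i ∈ s, F i u :=
  ⟨fun u v ↦ by simp only [(hF _).map_add, Finset.sum_add_distrib],
    fun r u ↦ by simp only [(hF _).map_smul, Finset.smul_sum]⟩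

theorem isBilin_mul (hg : IsLinearMap ℝ g) (hh : IsLinearMap ℝ h) : IsBilin fun u v ↦ g u * h v :=
  ⟨fun v ↦ isLinearMap_mul_const hg (h v), fun u ↦ isLinearMap_const_mul (g u) hh⟩

theorem isLinearMap_map_sum {ι : Type*} [Fintype ι] (hg : IsLinearMap ℝ g) (c : ι → ℝ)
    (b : ι → E) : g (∑ i, c i • b i) = ∑ i, c i * g (b i) := by
  have h := map_sum (hg.mk' g) (fun i ↦ c i • b i) Finset.univ
  simp only [IsLinearMap.mk'_apply, hg.map_smul, smul_eq_mul] at h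
  exact h

end traces

section orthonormal

variable {ι E : Type*} [Fintype ι] [NormedAddCommGroup E] [InnerProductSpace ℝ E]
  {B : E → E → ℝ}

/-- The trace of a bilinear form does not depend on the orthonormal basis. -/
theorem sum_bilin_eq (hB : IsBilin B) (b b' : OrthonormalBasis ι ℝ E) :
    ∑ i, B (b i) (b i) = ∑ i, B (b' i) (b' i) := by
  have h1 (i : ι) : B (b i) (b i) = ∑ j, inner ℝ (b i) (b' j) * B (b i) (b' j) := by
    rw [← isLinearMap_map_sum (hB.2 (b i))]
    congr 1
    conv_lhs => rw [← b'.sum_repr' (b i)]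
    simp only [real_inner_comm]
  have h2 (j : ι) : B (b' j) (b' j) = ∑ i, inner ℝ (b i) (b' j) * B (b i) (b' j) := by
    rw [← isLinearMap_map_sum (hB.1 (b' j)), b.sum_repr' (b' j)]
  simp only [h1, h2]
  exact Finset.sum_comm

/-- Each index fills two of the four slots of `G`. The bases are exchanged for one index at a time,
so bilinearity in one pair is needed only with the other pair on the diagonal. -/
theorem sum_sum_bilin_eq {G : E → E → E → E → ℝ} (h₁ : ∀ a, IsBilin fun u v ↦ G u v a a)
    (h₂ : ∀ a, IsBilin fun u v ↦ G a a u v) (b b' : OrthonormalBasis ι ℝ E) :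
    ∑ i, ∑ j, G (b i) (b i) (b j) (b j) = ∑ i, ∑ j, G (b' i) (b' i) (b' j) (b' j) := by
  simp only [fun i ↦ sum_bilin_eq (h₂ (b i)) b b']
  rw [Finset.sum_comm]
  simp only [fun j ↦ sum_bilin_eq (h₁ (b' j)) b b']
  exact Finset.sum_comm

end orthonormal

section products

theorem dir_sum_mul {ι : Type*} [Fintype ι] {g h : ι → M → ℝ}
    (hg : ∀ i, FSmoothAt (n := n) (g i) x) (hh : ∀ i, FSmoothAt (n := n) (h i) x) (u : Tan n x) :
    FSmoothAt (n := n) (fun y ↦ ∑ i, g i y * h i y) x ∧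
    dir (fun y ↦ ∑ i, g i y * h i y) u = ∑ i, (dir (g i) u * h i x + g i x * dir (h i) u) := by
  refine ⟨FSmoothAt.sum _ fun i _ ↦ (hg i).mul (hh i), ?_⟩
  rw [(dir_sum (F := fun i y ↦ g i y * h i y) Finset.univ
    (fun i _ ↦ ((hg i).diff.mul (hh i).diff)) u).2]
  refine Finset.sum_congr rfl fun i _ ↦ ?_
  rw [dir_mul (hg i).diff (hh i).diff]
  ring

theorem dir_sum_sum_mul {ι : Type*} [Fintype ι] {g h : ι → ι → M → ℝ}
    (hg : ∀ i j, FSmoothAt (n := n) (g i j) x) (hh : ∀ i j, FSmoothAt (n := n) (h i j) x)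
    (u : Tan n x) :
    FSmoothAt (n := n) (fun y ↦ ∑ i, ∑ j, g i j y * h i j y) x ∧
    dir (fun y ↦ ∑ i, ∑ j, g i j y * h i j y) u
      = ∑ i, ∑ j, (dir (g i j) u * h i j x + g i j x * dir (h i j) u) := by
  refine ⟨FSmoothAt.sum _ fun i _ ↦ (dir_sum_mul (hg i) (hh i) u).1, ?_⟩
  rw [(dir_sum Finset.univ (fun i _ ↦ (dir_sum_mul (hg i) (hh i) u).1.diff) u).2]
  exact Finset.sum_congr rfl fun i _ ↦ (dir_sum_mul (hg i) (hh i) u).2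

theorem dir_sum_sum_mul_mul {ι : Type*} [Fintype ι] {f g h : ι → ι → M → ℝ}
    (hf : ∀ i j, FSmoothAt (n := n) (f i j) x)
    (hg : ∀ i j, FSmoothAt (n := n) (g i j) x) (hh : ∀ i j, FSmoothAt (n := n) (h i j) x)
    (u : Tan n x) :
    FSmoothAt (n := n) (fun y ↦ ∑ i, ∑ j, f i j y * g i j y * h i j y) x ∧
    dir (fun y ↦ ∑ i, ∑ j, f i j y * g i j y * h i j y) u
      = ∑ i, ∑ j, (dir (f i j) u * g i j x * h i j x + f i j x * dir (g i j) u * h i j x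
        + f i j x * g i j x * dir (h i j) u) := by
  have h2 := dir_sum_sum_mul (fun i j ↦ (hf i j).mul (hg i j)) hh u
  refine ⟨h2.1, h2.2.trans ?_⟩
  refine Finset.sum_congr rfl fun i _ ↦ Finset.sum_congr rfl fun j _ ↦ ?_
  have h3 := dir_mul (hf i j).diff (hg i j).diff u
  have h4 : dir (f i j * g i j) u = dir (fun y ↦ f i j y * g i j y) u := rfl
  rw [h4, h3, Pi.mul_apply]
  ring

theorem TSmoothAt.of_one {α : Tensor n M 1}
    (hlin : ∀ᶠ y in 𝓝 x, IsLinearMap ℝ fun u ↦ α y ![u])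
    (hs : ∀ A : VField n M, VSmoothAt A x → FSmoothAt (n := n) (fun y ↦ α y ![A y]) x) :
    TSmoothAt α x := by
  refine ⟨hlin.mono fun y hy ↦ IsMulti.of_linear_one hy, fun V hV ↦ ?_⟩
  have e (y : M) : (fun s : Fin 1 ↦ V s y) = ![V 0 y] := by
    funext s; fin_cases s; rfl
  simpa only [e] using hs (V 0) (hV 0)

end products

/-! ### Derivatives of the contractions that occur in the formula. -/

variable {f : M → ℝ} {φ : (x : M) → Tan n x →L[ℝ] Tan n x →L[ℝ] ℝ}

theorem covDeriv_sub_const_mul {k : ℕ} {S T : Tensor n M k} (hS : TDiffAt S x) (hT : TDiffAt T x)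
    (c : ℝ) (v : Fin (k + 1) → Tan n x) :
    covDeriv (fun y w ↦ S y w - c * T y w) x v = covDeriv S x v - c * covDeriv T x v := by
  have h1 := hS.diff _ fun s ↦ ext_diff (v s.castSucc)
  have h2 := hT.diff _ fun s ↦ ext_diff (v s.castSucc)
  have h3 : FDiffAt (n := n) (fun y ↦ c * T y fun s ↦ ext (v s.castSucc) y) x :=
    mdifferentiableAt_const.mul h2
  simp only [covDeriv, Finset.sum_sub_distrib, ← Finset.mul_sum]
  rw [dir_sub h1 h3, dir_const_mul c h2]
  ring

/-- The derivative of the trace of a 2-tensor. -/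
theorem dir_trace {T : Tensor n M 2} (hT : TSmoothAt T x)
    (b : OrthonormalBasis (Fin n) ℝ (Tan n x)) (u : Tan n x) :
    FSmoothAt (n := n) (fun y ↦ ∑ i, T y ![onb y i, onb y i]) x ∧
    dir (fun y ↦ ∑ i, T y ![onb y i, onb y i]) u = ∑ i, covDeriv T x ![b i, b i, u] := by
  obtain ⟨E, hE, hEx, hb⟩ := exists_parallel_frame b
  -- The bases `onb y` are chosen point by point, without continuity; near `x` they are replaced by
  -- an orthonormal frame that is parallel at `x`.
  have ev : (fun y ↦ ∑ i, T y ![onb y i, onb y i]) =ᶠ[𝓝 x] fun y ↦ ∑ i, T y ![E i y, E i y] := by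
    filter_upwards [hb, hT.multi] with y ⟨b', hb'⟩ hm
    rw [sum_bilin_eq hm.bilin_two (onb y) b']
    simp only [hb']
  have hs (i) := hT.smooth_two (hE i).1 (hE i).1
  refine ⟨(FSmoothAt.sum _ fun i _ ↦ hs i).congr_of_eventuallyEq ev, ?_⟩
  rw [dir_congr ev, (dir_sum Finset.univ (fun i _ ↦ (hs i).diff) u).2]
  refine Finset.sum_congr rfl fun i _ ↦ ?_
  rw [← covDeriv_two_parallel hT.diff (hE i) (hE i), hEx]

/-- The contraction of a 3-tensor over the last two variables. -/
def contractLast (T : Tensor n M 3) : Tensor n M 1 :=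
  fun y v ↦ ∑ k, T y ![v 0, onb y k, onb y k]

/-- The contraction of a 3-tensor over the first two variables. -/
def contractFirst (T : Tensor n M 3) : Tensor n M 1 :=
  fun y v ↦ ∑ k, T y ![onb y k, onb y k, v 0]

theorem covDeriv_contractLast {T : Tensor n M 3} (hT : TSmoothAt T x)
    (b : OrthonormalBasis (Fin n) ℝ (Tan n x)) (a u : Tan n x) :
    TSmoothAt (contractLast T) x ∧
    covDeriv (contractLast T) x ![a, u] = ∑ k, covDeriv T x ![a, b k, b k, u] := by
  obtain ⟨E, hE, hEx, hb⟩ := exists_parallel_frame b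
  have ev (A : VField n M) : (fun y ↦ contractLast T y ![A y])
      =ᶠ[𝓝 x] fun y ↦ ∑ i, T y ![A y, E i y, E i y] := by
    filter_upwards [hb, hT.multi] with y ⟨b', hb'⟩ hm
    simp only [contractLast, Matrix.cons_val_zero]
    rw [sum_bilin_eq (B := fun u v ↦ T y ![A y, u, v])
      ⟨fun v ↦ hm.linear_three_snd _ _, fun v ↦ hm.linear_three_trd _ _⟩ (onb y) b']
    simp only [hb']
  have hs : TSmoothAt (contractLast T) x := by
    refine TSmoothAt.of_one (hT.multi.mono fun y hy ↦ isLinearMap_sum _ fun k ↦ ?_) fun A hA ↦ ?_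
    · exact hy.linear_three_fst _ _
    · exact (FSmoothAt.sum _ fun i _ ↦
        hT.smooth_three hA (hE i).1 (hE i).1).congr_of_eventuallyEq (ev A)
  refine ⟨hs, ?_⟩
  obtain ⟨A, hA, rfl⟩ := exists_parallelAt a
  rw [covDeriv_one_parallel hs.diff hA, dir_congr (ev A), (dir_sum Finset.univ (fun i _ ↦
    (hT.smooth_three hA.1 (hE i).1 (hE i).1).diff) u).2]
  refine Finset.sum_congr rfl fun i _ ↦ ?_
  rw [← covDeriv_three_parallel hT.diff hA (hE i) (hE i), hEx]

theorem covDeriv_contractFirst {T : Tensor n M 3} (hT : TSmoothAt T x)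
    (b : OrthonormalBasis (Fin n) ℝ (Tan n x)) (a u : Tan n x) :
    TSmoothAt (contractFirst T) x ∧
    covDeriv (contractFirst T) x ![a, u] = ∑ k, covDeriv T x ![b k, b k, a, u] := by
  obtain ⟨E, hE, hEx, hb⟩ := exists_parallel_frame b
  have ev (A : VField n M) : (fun y ↦ contractFirst T y ![A y])
      =ᶠ[𝓝 x] fun y ↦ ∑ i, T y ![E i y, E i y, A y] := by
    filter_upwards [hb, hT.multi] with y ⟨b', hb'⟩ hm
    simp only [contractFirst, Matrix.cons_val_zero]
    rw [sum_bilin_eq (B := fun u v ↦ T y ![u, v, A y])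
      ⟨fun v ↦ hm.linear_three_fst _ _, fun v ↦ hm.linear_three_snd _ _⟩ (onb y) b']
    simp only [hb']
  have hs : TSmoothAt (contractFirst T) x := by
    refine TSmoothAt.of_one (hT.multi.mono fun y hy ↦ isLinearMap_sum _ fun k ↦ ?_) fun A hA ↦ ?_
    · exact hy.linear_three_trd _ _
    · exact (FSmoothAt.sum _ fun i _ ↦
        hT.smooth_three (hE i).1 (hE i).1 hA).congr_of_eventuallyEq (ev A)
  refine ⟨hs, ?_⟩
  obtain ⟨A, hA, rfl⟩ := exists_parallelAt a
  rw [covDeriv_one_parallel hs.diff hA, dir_congr (ev A), (dir_sum Finset.univ (fun i _ ↦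
    (hT.smooth_three (hE i).1 (hE i).1 hA.1).diff) u).2]
  refine Finset.sum_congr rfl fun i _ ↦ ?_
  rw [← covDeriv_three_parallel hT.diff (hE i) (hE i) hA, hEx]

theorem dir_lap (hf : FSmoothAt (n := n) f x) (b : OrthonormalBasis (Fin n) ℝ (Tan n x))
    (u : Tan n x) : dir (lap n f) u = ∑ k, covDeriv (hess n f) x ![b k, b k, u] :=
  (dir_trace (hess_smooth hf) b u).2

/-- The differential of tr φ is a contraction of ∇φ at every point, so it can be differentiated
again under the contraction. -/
theorem hess_tr (hφ : ∀ y, TSmoothAt (toTensor φ) y) (b : OrthonormalBasis (Fin n) ℝ (Tan n x))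
    (a u : Tan n x) :
    hess n (tr φ) x ![a, u] = ∑ k, covDeriv (covDeriv (toTensor φ)) x ![b k, b k, a, u] := by
  have h : diff n (tr φ) = contractFirst (covDeriv (toTensor φ)) := by
    funext y v
    rw [diff_apply]
    exact (dir_trace (hφ y) (onb y) (v 0)).2
  rw [hess, h, (covDeriv_contractFirst (hφ x).covDeriv b a u).2]

theorem covDeriv_codazziForm (hφ : TSmoothAt (toTensor φ) x) (c : ℝ)
    (b : OrthonormalBasis (Fin n) ℝ (Tan n x)) (a u : Tan n x) :
    covDeriv (codazziForm φ c) x ![a, u]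
      = ∑ k, covDeriv (covDeriv (toTensor φ)) x ![a, b k, b k, u]
        - c * ∑ k, covDeriv (covDeriv (toTensor φ)) x ![b k, b k, a, u] := by
  have h1 := covDeriv_contractLast hφ.covDeriv b a u
  have h2 := covDeriv_contractFirst hφ.covDeriv b a u
  rw [← h1.2, ← h2.2, ← covDeriv_sub_const_mul h1.1.diff h2.1.diff]
  rfl

theorem grad_inner (f : M → ℝ) (w : Tan n x) : inner ℝ (grad n f x) w = diff n f x ![w] := by
  rw [diff_apply]
  exact sharp_inner (mvfderiv (𝓡 n) f x).toLinearMap w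

theorem inner_grad_grad (f h : M → ℝ) (b : OrthonormalBasis (Fin n) ℝ (Tan n x)) :
    inner ℝ (grad n f x) (grad n h x) = ∑ i, diff n f x ![b i] * dir h (b i) := by
  rw [← b.sum_inner_mul_inner]
  refine Finset.sum_congr rfl fun i _ ↦ ?_
  rw [grad_inner, real_inner_comm, grad_inner, diff_apply h]
  rfl

theorem norm_grad_sq (f : M → ℝ) (b : OrthonormalBasis (Fin n) ℝ (Tan n x)) :
    ‖grad n f x‖ ^ 2 = ∑ i, diff n f x ![b i] * diff n f x ![b i] := by
  rw [← real_inner_self_eq_norm_sq, inner_grad_grad f f b]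
  simp only [diff_apply, Matrix.cons_val_zero]

theorem grad_eq_sum (f : M → ℝ) (b : OrthonormalBasis (Fin n) ℝ (Tan n x)) :
    grad n f x = ∑ i, diff n f x ![b i] • b i := by
  conv_lhs => rw [← b.sum_repr' (grad n f x)]
  simp only [real_inner_comm (grad n f x), grad_inner]

theorem inner_sharp_grad (f h : M → ℝ) (b : OrthonormalBasis (Fin n) ℝ (Tan n x)) :
    inner ℝ (sharp (φ x (grad n f x))) (grad n h x)
      = ∑ i, (∑ j, diff n f x ![b j] * φ x (b j) (b i)) * dir h (b i) := by
  rw [← b.sum_inner_mul_inner]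
  refine Finset.sum_congr rfl fun i _ ↦ ?_
  rw [real_inner_comm (grad n h x) (b i), grad_inner, diff_apply h]
  congr 1
  have := sharp_inner (φ x (grad n f x)).toLinearMap (b i)
  refine Eq.trans this ?_
  simp [grad_eq_sum f b]

variable (n) in
/-- The 1-tensor field with components `∑ᵢ f_i f_{ik}`. -/
def gradFlux (f : M → ℝ) : Tensor n M 1 :=
  fun y v ↦ ∑ i, diff n f y ![onb y i] * hess n f y ![onb y i, v 0]

theorem dir_norm_grad_sq (hf : FSmoothAt (n := n) f x) (b : OrthonormalBasis (Fin n) ℝ (Tan n x))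
    (u : Tan n x) :
    FSmoothAt (n := n) (fun y ↦ ‖grad n f y‖ ^ 2) x ∧
    dir (fun y ↦ ‖grad n f y‖ ^ 2) u = 2 * ∑ i, diff n f x ![b i] * hess n f x ![b i, u] := by
  obtain ⟨E, hE, hEx, hb⟩ := exists_parallel_frame b
  have ev : (fun y ↦ ‖grad n f y‖ ^ 2)
      =ᶠ[𝓝 x] fun y ↦ ∑ i, diff n f y ![E i y] * diff n f y ![E i y] := by
    filter_upwards [hb] with y ⟨b', hb'⟩
    rw [norm_grad_sq f b']
    simp only [hb']
  have hs (i) := (diff_smooth hf).smooth_one (hE i).1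
  have hd := dir_sum_mul hs hs u
  refine ⟨hd.1.congr_of_eventuallyEq ev, ?_⟩
  rw [dir_congr ev, hd.2, Finset.mul_sum]
  refine Finset.sum_congr rfl fun i _ ↦ ?_
  rw [← covDeriv_one_parallel (diff_smooth hf).diff (hE i), hEx, hess]
  ring

theorem covDeriv_gradFlux (hf : FSmoothAt (n := n) f x)
    (b : OrthonormalBasis (Fin n) ℝ (Tan n x)) (a u : Tan n x) :
    TSmoothAt (gradFlux n f) x ∧
    covDeriv (gradFlux n f) x ![a, u]
      = ∑ i, (hess n f x ![b i, u] * hess n f x ![b i, a]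
        + diff n f x ![b i] * covDeriv (hess n f) x ![b i, a, u]) := by
  obtain ⟨E, hE, hEx, hb⟩ := exists_parallel_frame b
  have hD := diff_smooth hf
  have hH := hess_smooth hf
  have ev (A : VField n M) : (fun y ↦ gradFlux n f y ![A y])
      =ᶠ[𝓝 x] fun y ↦ ∑ i, diff n f y ![E i y] * hess n f y ![E i y, A y] := by
    filter_upwards [hb, hD.multi, hH.multi] with y ⟨b', hb'⟩ h1 h2
    simp only [gradFlux, Matrix.cons_val_zero]
    rw [sum_bilin_eq (isBilin_mul h1.linear_one (h2.linear_two_fst (A y))) (onb y) b']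
    simp only [hb']
  have hd {A : VField n M} (hA : VSmoothAt A x) := dir_sum_mul
    (fun i ↦ hD.smooth_one (hE i).1) (fun i ↦ hH.smooth_two (hE i).1 hA) u
  have hs : TSmoothAt (gradFlux n f) x := by
    refine TSmoothAt.of_one (hH.multi.mono fun y hy ↦ isLinearMap_sum _ fun k ↦ ?_) fun A hA ↦ ?_
    · exact isLinearMap_const_mul _ (hy.linear_two_snd _)
    · exact (hd hA).1.congr_of_eventuallyEq (ev A)
  refine ⟨hs, ?_⟩
  obtain ⟨A, hA, rfl⟩ := exists_parallelAt a
  rw [covDeriv_one_parallel hs.diff hA, dir_congr (ev A), (hd hA.1).2]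
  refine Finset.sum_congr rfl fun i _ ↦ ?_
  rw [← covDeriv_two_parallel hH.diff (hE i) hA, ← covDeriv_one_parallel hD.diff (hE i), hEx, hess]

theorem covDeriv_const_mul {k : ℕ} {T : Tensor n M k} (hT : TDiffAt T x) (c : ℝ)
    (v : Fin (k + 1) → Tan n x) :
    covDeriv (fun y w ↦ c * T y w) x v = c * covDeriv T x v := by
  have h2 := hT.diff _ fun s ↦ ext_diff (v s.castSucc)
  simp only [covDeriv, ← Finset.mul_sum]
  rw [dir_const_mul c h2]
  ring

/-- At every point `gradFlux` is half the differential of |∇f|². -/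
theorem hess_norm_grad_sq (hf : ∀ y, FSmoothAt (n := n) f y) (v : Fin 2 → Tan n x) :
    hess n (fun y ↦ ‖grad n f y‖ ^ 2) x v = 2 * covDeriv (gradFlux n f) x v := by
  have h : diff n (fun y ↦ ‖grad n f y‖ ^ 2) = fun y v ↦ 2 * gradFlux n f y v := by
    funext y v
    rw [diff_apply]
    exact (dir_norm_grad_sq (hf y) (onb y) (v 0)).2
  rw [hess, h, covDeriv_const_mul (covDeriv_gradFlux (hf x) (onb x) 0 0).1.diff]

/-- Contractions of two 2-tensors do not depend on the orthonormal basis. -/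
theorem sum_sum_mul_eq {E : Type*} [NormedAddCommGroup E] [InnerProductSpace ℝ E]
    {s t : (Fin 2 → E) → ℝ} (hs : IsMulti s) (ht : IsMulti t)
    (b b' : OrthonormalBasis (Fin n) ℝ E) :
    ∑ i, ∑ j, s ![b i, b j] * t ![b i, b j] = ∑ i, ∑ j, s ![b' i, b' j] * t ![b' i, b' j] :=
  sum_sum_bilin_eq (G := fun u v p q ↦ s ![u, p] * t ![v, q])
    (fun a ↦ isBilin_mul (hs.linear_two_fst a) (ht.linear_two_fst a))
    (fun a ↦ isBilin_mul (hs.linear_two_snd a) (ht.linear_two_snd a)) b b'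

theorem square_eq (hφ : TSmoothAt (toTensor φ) x) {h : M → ℝ} (hh : FSmoothAt (n := n) h x)
    (b : OrthonormalBasis (Fin n) ℝ (Tan n x)) :
    square φ h x = ∑ i, ∑ j, φ x (b i) (b j) * hess n h x ![b i, b j] :=
  sum_sum_mul_eq hφ.multi.self_of_nhds (hess_smooth hh).multi.self_of_nhds (onb x) b

theorem dir_square (hφ : ∀ y, TSmoothAt (toTensor φ) y) (hf : ∀ y, FSmoothAt (n := n) f y)
    (b : OrthonormalBasis (Fin n) ℝ (Tan n x)) (u : Tan n x) :
    dir (square φ f) u = ∑ i, ∑ j, (covDeriv (toTensor φ) x ![b i, b j, u] * hess n f x ![b i, b j]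
      + φ x (b i) (b j) * covDeriv (hess n f) x ![b i, b j, u]) := by
  obtain ⟨E, hE, hEx, hb⟩ := exists_parallel_frame b
  have ev : square φ f
      =ᶠ[𝓝 x] fun y ↦ ∑ i, ∑ j, toTensor φ y ![E i y, E j y] * hess n f y ![E i y, E j y] := by
    filter_upwards [hb] with y ⟨b', hb'⟩
    rw [square_eq (hφ y) (hf y) b']
    simp only [hb']
    rfl
  have hd := dir_sum_sum_mul (fun i j ↦ (hφ x).smooth_two (hE i).1 (hE j).1)
    (fun i j ↦ (hess_smooth (hf x)).smooth_two (hE i).1 (hE j).1) u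
  rw [dir_congr ev, hd.2]
  refine Finset.sum_congr rfl fun i _ ↦ Finset.sum_congr rfl fun j _ ↦ ?_
  rw [← covDeriv_two_parallel (hφ x).diff (hE i) (hE j),
    ← covDeriv_two_parallel (hess_smooth (hf x)).diff (hE i) (hE j), hEx, hEx]
  rfl

theorem covDeriv_fluxA (hφ : TSmoothAt (toTensor φ) x) (hf : FSmoothAt (n := n) f x)
    (b : OrthonormalBasis (Fin n) ℝ (Tan n x)) (a u : Tan n x) :
    TSmoothAt (fluxA φ f) x ∧
    covDeriv (fluxA φ f) x ![a, u] = ∑ i, ∑ j,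
      (hess n f x ![b i, u] * diff n f x ![b j]
          * (covDeriv (toTensor φ) x ![b j, b i, a] - covDeriv (toTensor φ) x ![b j, a, b i])
        + diff n f x ![b i] * hess n f x ![b j, u]
          * (covDeriv (toTensor φ) x ![b j, b i, a] - covDeriv (toTensor φ) x ![b j, a, b i])
        + diff n f x ![b i] * diff n f x ![b j]
          * (covDeriv (covDeriv (toTensor φ)) x ![b j, b i, a, u]
            - covDeriv (covDeriv (toTensor φ)) x ![b j, a, b i, u])) := by
  obtain ⟨E, hE, hEx, hb⟩ := exists_parallel_frame b
  have hD := diff_smooth hf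
  have hT := hφ.covDeriv
  have ev (A : VField n M) : (fun y ↦ fluxA φ f y ![A y]) =ᶠ[𝓝 x] fun y ↦ ∑ i, ∑ j,
      diff n f y ![E i y] * diff n f y ![E j y]
        * (covDeriv (toTensor φ) y ![E j y, E i y, A y]
          - covDeriv (toTensor φ) y ![E j y, A y, E i y]) := by
    filter_upwards [hb, hD.multi, hT.multi] with y ⟨b', hb'⟩ h1 h2
    simp only [fluxA, Matrix.cons_val_zero]
    -- The slots `u`, `v` hold the two occurrences of the index i, and `p`, `q` those of j.
    rw [sum_sum_bilin_eq (G := fun u v p q ↦ diff n f y ![u] * diff n f y ![p]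
        * (covDeriv (toTensor φ) y ![q, v, A y] - covDeriv (toTensor φ) y ![q, A y, v]))
      (fun a ↦ isBilin_mul (isLinearMap_mul_const h1.linear_one _)
        (isLinearMap_sub (h2.linear_three_snd _ _) (h2.linear_three_trd _ _)))
      (fun a ↦ isBilin_mul (isLinearMap_const_mul _ h1.linear_one)
        (isLinearMap_sub (h2.linear_three_fst _ _) (h2.linear_three_fst _ _))) (onb y) b']
    simp only [hb']
  have hc {A : VField n M} (hA : VSmoothAt A x) (i j : Fin n) : FSmoothAt (n := n) (fun y ↦
      covDeriv (toTensor φ) y ![E j y, E i y, A y]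
        - covDeriv (toTensor φ) y ![E j y, A y, E i y]) x :=
    (hT.smooth_three (hE j).1 (hE i).1 hA).sub (hT.smooth_three (hE j).1 hA (hE i).1)
  have hd {A : VField n M} (hA : VSmoothAt A x) := dir_sum_sum_mul_mul
    (fun i (_ : Fin n) ↦ hD.smooth_one (hE i).1) (fun (_ : Fin n) j ↦ hD.smooth_one (hE j).1)
    (hc hA) u
  have hs : TSmoothAt (fluxA φ f) x := by
    refine TSmoothAt.of_one (hT.multi.mono fun y hy ↦ isLinearMap_sum _ fun i ↦
      isLinearMap_sum _ fun j ↦ ?_) fun A hA ↦ ?_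
    · exact isLinearMap_const_mul _
        (isLinearMap_sub (hy.linear_three_trd _ _) (hy.linear_three_snd _ _))
    · exact (hd hA).1.congr_of_eventuallyEq (ev A)
  refine ⟨hs, ?_⟩
  obtain ⟨A, hA, rfl⟩ := exists_parallelAt a
  rw [covDeriv_one_parallel hs.diff hA, dir_congr (ev A), (hd hA.1).2]
  refine Finset.sum_congr rfl fun i _ ↦ Finset.sum_congr rfl fun j _ ↦ ?_
  rw [dir_sub (hT.smooth_three (hE j).1 (hE i).1 hA.1).diff
      (hT.smooth_three (hE j).1 hA.1 (hE i).1).diff,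
    ← covDeriv_three_parallel hT.diff (hE j) (hE i) hA,
    ← covDeriv_three_parallel hT.diff (hE j) hA (hE i),
    ← covDeriv_one_parallel hD.diff (hE i), ← covDeriv_one_parallel hD.diff (hE j), hEx, hEx]
  rfl

theorem covDeriv_fluxB (hφ : TSmoothAt (toTensor φ) x) (hf : FSmoothAt (n := n) f x)
    (b : OrthonormalBasis (Fin n) ℝ (Tan n x)) (a u : Tan n x) :
    TSmoothAt (fluxB φ f) x ∧
    covDeriv (fluxB φ f) x ![a, u] = ∑ i, ∑ j,
      (hess n f x ![b j, u] * φ x (b i) (b j) * hess n f x ![b i, a]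
        + diff n f x ![b j] * covDeriv (toTensor φ) x ![b i, b j, u] * hess n f x ![b i, a]
        + diff n f x ![b j] * φ x (b i) (b j) * covDeriv (hess n f) x ![b i, a, u]) := by
  obtain ⟨E, hE, hEx, hb⟩ := exists_parallel_frame b
  have hD := diff_smooth hf
  have hH := hess_smooth hf
  have ev (A : VField n M) : (fun y ↦ fluxB φ f y ![A y]) =ᶠ[𝓝 x] fun y ↦ ∑ i, ∑ j,
      diff n f y ![E j y] * toTensor φ y ![E i y, E j y] * hess n f y ![E i y, A y] := by
    filter_upwards [hb, hD.multi, hφ.multi, hH.multi] with y ⟨b', hb'⟩ h1 h2 h3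
    have := sum_sum_bilin_eq (G := fun u v p q ↦ diff n f y ![p] * toTensor φ y ![u, q]
        * hess n f y ![v, A y])
      (fun a ↦ isBilin_mul (isLinearMap_const_mul _ (h2.linear_two_fst _)) (h3.linear_two_fst _))
      (fun a ↦ (⟨fun _ ↦ isLinearMap_mul_const (isLinearMap_mul_const h1.linear_one _) _,
        fun _ ↦ isLinearMap_mul_const (isLinearMap_const_mul _ (h2.linear_two_snd _)) _⟩ :
          IsBilin _)) (onb y) b'
    simp only [hb'] at this
    exact this
  have hd {A : VField n M} (hA : VSmoothAt A x) := dir_sum_sum_mul_mul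
    (fun (_ : Fin n) j ↦ hD.smooth_one (hE j).1) (fun i j ↦ hφ.smooth_two (hE i).1 (hE j).1)
    (fun i _ ↦ hH.smooth_two (hE i).1 hA) u
  have hs : TSmoothAt (fluxB φ f) x := by
    refine TSmoothAt.of_one (hH.multi.mono fun y hy ↦ isLinearMap_sum _ fun i ↦
      isLinearMap_sum _ fun j ↦ ?_) fun A hA ↦ ?_
    · exact isLinearMap_const_mul _ (hy.linear_two_snd _)
    · exact (hd hA).1.congr_of_eventuallyEq (ev A)
  refine ⟨hs, ?_⟩
  obtain ⟨A, hA, rfl⟩ := exists_parallelAt a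
  rw [covDeriv_one_parallel hs.diff hA, dir_congr (ev A), (hd hA.1).2]
  refine Finset.sum_congr rfl fun i _ ↦ Finset.sum_congr rfl fun j _ ↦ ?_
  rw [← covDeriv_two_parallel hφ.diff (hE i) (hE j), ← covDeriv_two_parallel hH.diff (hE i) hA,
    ← covDeriv_one_parallel hD.diff (hE j), hEx, hEx]
  rfl

theorem div_eq {α : Tensor n M 1} (hα : TDiffAt α x) (b : OrthonormalBasis (Fin n) ℝ (Tan n x)) :
    div α x = ∑ k, covDeriv α x ![b k, b k] :=
  sum_bilin_eq hα.covDeriv_multi.bilin_two (onb x) b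

/-! ### The index computation at a point. -/

section algebra

variable {ι : Type*} [Fintype ι]

theorem sum_swap_left (g : ι → ι → ι → ℝ) :
    ∑ i, ∑ j, ∑ k, g i j k = ∑ i, ∑ j, ∑ k, g j i k := Finset.sum_comm

theorem sum_swap_right (g : ι → ι → ι → ℝ) :
    ∑ i, ∑ j, ∑ k, g i j k = ∑ i, ∑ j, ∑ k, g i k j :=
  Finset.sum_congr rfl fun _ _ ↦ Finset.sum_comm

theorem sum_rotate (g : ι → ι → ι → ℝ) :
    ∑ i, ∑ j, ∑ k, g i j k = ∑ k, ∑ i, ∑ j, g i j k :=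
  (sum_swap_right g).trans Finset.sum_comm

/-- The reversal of four indices is a product of six adjacent transpositions. -/
theorem sum_reverse (g : ι → ι → ι → ι → ℝ) :
    ∑ i, ∑ j, ∑ k, ∑ m, g i j k m = ∑ i, ∑ j, ∑ k, ∑ m, g m k j i := by
  have h1 (g : ι → ι → ι → ι → ℝ) :
      ∑ i, ∑ j, ∑ k, ∑ m, g i j k m = ∑ i, ∑ j, ∑ k, ∑ m, g j i k m := Finset.sum_comm
  have h2 (g : ι → ι → ι → ι → ℝ) :
      ∑ i, ∑ j, ∑ k, ∑ m, g i j k m = ∑ i, ∑ j, ∑ k, ∑ m, g i k j m :=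
    Finset.sum_congr rfl fun _ _ ↦ Finset.sum_comm
  have h3 (g : ι → ι → ι → ι → ℝ) :
      ∑ i, ∑ j, ∑ k, ∑ m, g i j k m = ∑ i, ∑ j, ∑ k, ∑ m, g i j m k :=
    Finset.sum_congr rfl fun _ _ ↦ Finset.sum_congr rfl fun _ _ ↦ Finset.sum_comm
  exact (h1 _).trans <| (h2 _).trans <| (h3 _).trans <| (h1 _).trans <| (h2 _).trans (h1 _)

variable {F : ι → ℝ} {H P : ι → ι → ℝ} {H3 P3 : ι → ι → ι → ℝ} {P4 R : ι → ι → ι → ι → ℝ}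

/-- The commutation of the third derivatives of `f` and of the second derivatives of `φ`. -/
theorem sum_commutators (H3s : ∀ i j k, H3 i j k = H3 j i k)
    (H3c : ∀ i j k, H3 i j k - H3 i k j = -∑ m, R j k i m * F m)
    (P4c : ∀ i j k l, P4 i j k l - P4 i j l k
      = -(∑ m, R k l i m * P m j) - ∑ m, R k l j m * P i m)
    (Rl : ∀ i j k l, R i j k l = -R j i k l) (Rr : ∀ i j k l, R i j k l = -R i j l k)
    (Rp : ∀ i j k l, R i j k l = R k l i j) :
    ∑ i, ∑ j, ∑ k, P i j * F k * (H3 k i j - H3 i j k)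
      = ∑ i, ∑ j, ∑ k, F j * P j i * (H3 k k i - H3 i k k)
        + 2 * ∑ i, ∑ j, ∑ k, ∑ m, F i * F j * P i m * R m k j k
        + ∑ i, ∑ j, ∑ k, F i * F j * (P4 i k k j - P4 i k j k) := by
  -- With A = ∑ F_i F_j R_kjim P_mk and B = ∑ F_i F_j P_im R_mkjk, the four facts are: the left side
  -- is -A, the commutator with the Laplacian is -B, the curvature term is B, and the commutator of
  -- φ is -A - B.
  have e1 : ∑ i, ∑ j, ∑ k, P i j * F k * (H3 k i j - H3 i j k)
      = -∑ i, ∑ j, ∑ k, ∑ m, F i * F j * (R k j i m * P m k) := by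
    rw [sum_reverse]
    simp only [← Finset.sum_neg_distrib]
    refine Finset.sum_congr rfl fun i _ ↦ Finset.sum_congr rfl fun j _ ↦
      Finset.sum_congr rfl fun k _ ↦ ?_
    rw [H3s k i j, H3c, mul_neg, Finset.mul_sum, Finset.sum_neg_distrib]
    congr 1
    refine Finset.sum_congr rfl fun m _ ↦ ?_
    rw [Rl k j, Rr j k]; ring
  have e2 : ∑ i, ∑ j, ∑ k, F j * P j i * (H3 k k i - H3 i k k)
      = -∑ i, ∑ j, ∑ m, F i * F j * P i m * ∑ k, R m k j k := by
    rw [sum_rotate fun i j m ↦ F i * F j * P i m * ∑ k, R m k j k]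
    simp only [← Finset.sum_neg_distrib, Finset.mul_sum]
    refine Finset.sum_congr rfl fun i _ ↦ Finset.sum_congr rfl fun j _ ↦ ?_
    rw [Finset.sum_comm]
    refine Finset.sum_congr rfl fun k _ ↦ ?_
    rw [H3s i k k, H3c, mul_neg, Finset.mul_sum, ← Finset.sum_neg_distrib]
    refine Finset.sum_congr rfl fun m _ ↦ ?_
    rw [Rl k i, Rr i k]; ring
  have e3 : ∑ i, ∑ j, ∑ k, ∑ m, F i * F j * P i m * R m k j k
      = ∑ i, ∑ j, ∑ m, F i * F j * P i m * ∑ k, R m k j k := by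
    refine Finset.sum_congr rfl fun i _ ↦ Finset.sum_congr rfl fun j _ ↦ ?_
    rw [Finset.sum_comm]
    simp only [Finset.mul_sum]
  have e4 : ∑ i, ∑ j, ∑ k, F i * F j * (P4 i k k j - P4 i k j k)
      = -(∑ i, ∑ j, ∑ k, ∑ m, F i * F j * (R k j i m * P m k))
        - ∑ i, ∑ j, ∑ m, F i * F j * P i m * ∑ k, R m k j k := by
    rw [← e3]
    simp only [← Finset.sum_neg_distrib, ← Finset.sum_sub_distrib]
    refine Finset.sum_congr rfl fun i _ ↦ Finset.sum_congr rfl fun j _ ↦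
      Finset.sum_congr rfl fun k _ ↦ ?_
    rw [P4c, mul_sub, mul_neg, Finset.mul_sum, Finset.mul_sum, Finset.sum_sub_distrib,
      Finset.sum_neg_distrib]
    congr 1
    refine Finset.sum_congr rfl fun m _ ↦ ?_
    rw [Rp m k, Rl k j, Rr j k]; ring
  rw [e1, e2, e3, e4]
  ring

/-- The generalized Bochner formula in components at a point. -/
theorem sum_bochner (c : ℝ) (Hs : ∀ i j, H i j = H j i) (H3s : ∀ i j k, H3 i j k = H3 j i k)
    (H3c : ∀ i j k, H3 i j k - H3 i k j = -∑ m, R j k i m * F m)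
    (Ps : ∀ i j, P i j = P j i)
    (P4s : ∀ i j k l, P4 i j k l = P4 j i k l)
    (P4c : ∀ i j k l, P4 i j k l - P4 i j l k
      = -(∑ m, R k l i m * P m j) - ∑ m, R k l j m * P i m)
    (Rl : ∀ i j k l, R i j k l = -R j i k l) (Rr : ∀ i j k l, R i j k l = -R i j l k)
    (Rp : ∀ i j k l, R i j k l = R k l i j) :
    (1 / 2) * ∑ i, ∑ j, P i j * (2 * ∑ k, (H k j * H k i + F k * H3 k i j))
      = ∑ i, F i * ∑ j, ∑ k, (P3 j k i * H j k + P j k * H3 j k i)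
        + ∑ i, (∑ j, F j * P j i) * ∑ k, H3 k k i
        + 2 * ∑ i, ∑ j, ∑ k, P i j * H j k * H k i
        + 2 * ∑ i, ∑ j, ∑ k, ∑ m, F i * F j * P i m * R m k j k
        + c * ∑ i, ∑ j, (∑ k, P4 k k i j) * F i * F j
        - ∑ i, ∑ j, F i * F j * ∑ k, P4 i j k k
        + ∑ i, ∑ j, F i * F j * (∑ k, P4 i k k j - c * ∑ k, P4 k k i j)
        + ∑ k, ∑ i, ∑ j, (H i k * F j * (P3 j i k - P3 j k i) + F i * H j k * (P3 j i k - P3 j k i)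
          + F i * F j * (P4 j i k k - P4 j k i k))
        - ∑ k, ∑ i, ∑ j, (H j k * P i j * H i k + F j * P3 i j k * H i k
          + F j * P i j * H3 i k k) := by
  have key := sum_commutators H3s H3c P4c Rl Rr Rp
  simp only [mul_sub, Finset.sum_sub_distrib] at key
  have t1 : (1 / 2) * ∑ i, ∑ j, P i j * (2 * ∑ k, (H k j * H k i + F k * H3 k i j))
      = ∑ i, ∑ j, ∑ k, P i j * H j k * H k i + ∑ i, ∑ j, ∑ k, P i j * F k * H3 k i j := by
    simp only [← Finset.sum_add_distrib, Finset.mul_sum]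
    refine Finset.sum_congr rfl fun i _ ↦ Finset.sum_congr rfl fun j _ ↦
      Finset.sum_congr rfl fun k _ ↦ ?_
    rw [Hs k j]; ring
  have t2 : ∑ i, F i * ∑ j, ∑ k, (P3 j k i * H j k + P j k * H3 j k i)
      = ∑ i, ∑ j, ∑ k, F i * H j k * P3 j k i + ∑ i, ∑ j, ∑ k, P i j * F k * H3 i j k := by
    rw [sum_rotate fun i j k ↦ P i j * F k * H3 i j k]
    simp only [← Finset.sum_add_distrib, Finset.mul_sum]
    refine Finset.sum_congr rfl fun i _ ↦ Finset.sum_congr rfl fun j _ ↦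
      Finset.sum_congr rfl fun k _ ↦ ?_
    ring
  have t3 : ∑ i, (∑ j, F j * P j i) * ∑ k, H3 k k i = ∑ i, ∑ j, ∑ k, F j * P j i * H3 k k i := by
    simp only [Finset.sum_mul]
    simp only [Finset.mul_sum]
  -- The part with `c` cancels the Hessian of the trace, so the formula holds for every `c`.
  have t4 : ∑ i, ∑ j, F i * F j * (∑ k, P4 i k k j - c * ∑ k, P4 k k i j)
      = ∑ i, ∑ j, ∑ k, F i * F j * P4 i k k j
        - c * ∑ i, ∑ j, (∑ k, P4 k k i j) * F i * F j := by
    simp only [mul_sub, Finset.sum_sub_distrib, Finset.mul_sum, Finset.sum_mul]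
    congr 1
    refine Finset.sum_congr rfl fun i _ ↦ Finset.sum_congr rfl fun j _ ↦
      Finset.sum_congr rfl fun k _ ↦ ?_
    ring
  -- The Hessian is symmetric in i, k and the bracket antisymmetric.
  have t5 : ∑ k, ∑ i, ∑ j, H i k * F j * (P3 j i k - P3 j k i) = 0 := by
    have h := sum_swap_left fun k i j ↦ H i k * F j * (P3 j i k - P3 j k i)
    have h' : ∑ i, ∑ k, ∑ j, H i k * F j * (P3 j i k - P3 j k i)
        = -∑ k, ∑ i, ∑ j, H i k * F j * (P3 j i k - P3 j k i) := by
      simp only [← Finset.sum_neg_distrib]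
      refine Finset.sum_congr rfl fun i _ ↦ Finset.sum_congr rfl fun j _ ↦
        Finset.sum_congr rfl fun k _ ↦ ?_
      rw [Hs i j]; ring
    linarith
  -- The first sum cancels against the divergence of `fluxB`, the second against the derivative of φ
  -- in ⟨∇f, ∇□f⟩.
  have t6 : ∑ k, ∑ i, ∑ j, F i * H j k * (P3 j i k - P3 j k i)
      = ∑ k, ∑ i, ∑ j, F j * P3 i j k * H i k - ∑ i, ∑ j, ∑ k, F i * H j k * P3 j k i := by
    simp only [mul_sub, Finset.sum_sub_distrib]
    congr 1
    · rw [sum_swap_right]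
      refine Finset.sum_congr rfl fun i _ ↦ Finset.sum_congr rfl fun j _ ↦
        Finset.sum_congr rfl fun k _ ↦ ?_
      ring
    · exact (sum_rotate fun i j k ↦ F i * H j k * P3 j k i).symm
  -- The first sum cancels the term with Δφ; the second is the half of the φ-commutator that `t4`
  -- lacks.
  have t7 : ∑ k, ∑ i, ∑ j, F i * F j * (P4 j i k k - P4 j k i k)
      = ∑ i, ∑ j, F i * F j * ∑ k, P4 i j k k - ∑ i, ∑ j, ∑ k, F i * F j * P4 i k j k := by
    rw [sum_swap_left fun i j k ↦ F i * F j * P4 i k j k]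
    simp only [Finset.mul_sum]
    rw [sum_rotate fun i j k ↦ F i * F j * P4 i j k k,
      sum_rotate fun i j k ↦ F j * F i * P4 j k i k]
    simp only [← Finset.sum_sub_distrib]
    refine Finset.sum_congr rfl fun i _ ↦ Finset.sum_congr rfl fun j _ ↦
      Finset.sum_congr rfl fun k _ ↦ ?_
    rw [P4s k j]; ring
  -- Removes one of the two copies of this sum on the right, since the left side has only one.
  have t8 : ∑ k, ∑ i, ∑ j, H j k * P i j * H i k = ∑ i, ∑ j, ∑ k, P i j * H j k * H k i := by
    rw [sum_rotate fun i j k ↦ P i j * H j k * H k i]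
    refine Finset.sum_congr rfl fun i _ ↦ Finset.sum_congr rfl fun j _ ↦
      Finset.sum_congr rfl fun k _ ↦ ?_
    rw [Hs j i]; ring
  have t9 : ∑ k, ∑ i, ∑ j, F j * P i j * H3 i k k = ∑ i, ∑ j, ∑ k, F j * P j i * H3 i k k := by
    rw [sum_rotate fun i j k ↦ F j * P j i * H3 i k k]
    simp only [Ps]
  simp only [Finset.sum_add_distrib] at t1 t2 ⊢
  rw [t5, t6, t7, t8, t9, t4, t3]
  linarith

end algebra

/-! ### The formula at a point, and the case of the metric. -/

theorem linear_eq_sum {E : Type*} [NormedAddCommGroup E] [InnerProductSpace ℝ E] {g : E → ℝ}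
    (hg : IsLinearMap ℝ g) (b : OrthonormalBasis (Fin n) ℝ E) (v : E) :
    g v = ∑ m, inner ℝ v (b m) * g (b m) := by
  rw [← isLinearMap_map_sum hg]
  conv_lhs => rw [← b.sum_repr' v]
  simp only [real_inner_comm]

theorem bochner_formula (hφ : ∀ y, TSmoothAt (toTensor φ) y)
    (hsymm : ∀ (x : M) (u v : Tan n x), φ x u v = φ x v u) (hf : ∀ y, FSmoothAt (n := n) f y)
    (c : ℝ) (x : M) (e : OrthonormalBasis (Fin n) ℝ (Tan n x)) :
    (1 / 2) * square φ (fun y ↦ ‖grad n f y‖ ^ 2) x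
      = inner ℝ (grad n f x) (grad n (square φ f) x)
        + inner ℝ (sharp (φ x (grad n f x))) (grad n (lap n f) x)
        + 2 * ∑ i, ∑ j, ∑ k, φ x (e i) (e j) * hess n f x ![e j, e k] * hess n f x ![e k, e i]
        + 2 * ∑ i, ∑ j, ∑ k, ∑ m, diff n f x ![e i] * diff n f x ![e j] * φ x (e i) (e m)
            * riem (e m) (e k) (e j) (e k)
        + c * ∑ i, ∑ j, hess n (tr φ) x ![e i, e j] * diff n f x ![e i] * diff n f x ![e j]
        - ∑ i, ∑ j, diff n f x ![e i] * diff n f x ![e j]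
            * ∑ k, covDeriv (covDeriv (toTensor φ)) x ![e i, e j, e k, e k]
        + ∑ i, ∑ j, diff n f x ![e i] * diff n f x ![e j]
            * covDeriv (codazziForm φ c) x ![e i, e j]
        + div (fluxA φ f) x
        - div (fluxB φ f) x := by
  have hφm := (hφ x).multi.self_of_nhds
  have hs : ∀ y (u v : Tan n y), toTensor φ y ![u, v] = toTensor φ y ![v, u] := hsymm
  have hs' (y : M) := covDeriv_symm_two (hφ y).diff (.of_forall hs)
  -- The zero vectors are fillers: only smoothness, which does not involve them, is extracted.
  rw [square_eq (hφ x) (dir_norm_grad_sq (hf x) e 0).1 e,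
    inner_grad_grad f (square φ f) e, inner_sharp_grad f (lap n f) e,
    div_eq (covDeriv_fluxA (hφ x) (hf x) e 0 0).1.diff e,
    div_eq (covDeriv_fluxB (hφ x) (hf x) e 0 0).1.diff e]
  simp only [hess_norm_grad_sq hf, (covDeriv_gradFlux (hf x) e _ _).2, dir_square hφ hf e,
    dir_lap (hf x) e, hess_tr hφ e, covDeriv_codazziForm (hφ x) c e,
    (covDeriv_fluxA (hφ x) (hf x) e _ _).2, (covDeriv_fluxB (hφ x) (hf x) e _ _).2]
  refine sum_bochner (F := fun i ↦ diff n f x ![e i]) (H := fun i j ↦ hess n f x ![e i, e j])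
    (P := fun i j ↦ φ x (e i) (e j)) (H3 := fun i j k ↦ covDeriv (hess n f) x ![e i, e j, e k])
    (P3 := fun i j k ↦ covDeriv (toTensor φ) x ![e i, e j, e k])
    (P4 := fun i j k l ↦ covDeriv (covDeriv (toTensor φ)) x ![e i, e j, e k, e l])
    (R := fun i j k l ↦ riem (e i) (e j) (e k) (e l)) c
    (fun i j ↦ hess_symm (hf x) _ _) (fun i j k ↦ covDeriv_hess_symm (.of_forall hf) _ _ _)
    (fun i j k ↦ ?_) (fun i j ↦ hsymm x _ _)
    (fun i j k l ↦ covDeriv_symm_three (hφ x).covDeriv.diff (.of_forall hs') _ _ _ _)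
    (fun i j k l ↦ ?_)
    (fun i j k l ↦ riem_swap_left _ _ _ _) (fun i j k l ↦ riem_swap_right _ _ _ _)
    (fun i j k l ↦ riem_pair _ _ _ _)
  · refine (ricci_one (diff_smooth (hf x)) _ _ _).trans ?_
    -- Expanding the curvature vector in the basis `e` turns the Ricci identity into components.
    rw [linear_eq_sum (diff_smooth (hf x)).multi.self_of_nhds.linear_one e]
    rfl
  · refine (ricci_two (hφ x) _ _ _ _).trans ?_
    rw [linear_eq_sum (hφm.linear_two_fst _) e, linear_eq_sum (hφm.linear_two_snd _) e]
    rfl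

section metric

theorem sum_inner_mul {x : M} (b : OrthonormalBasis (Fin n) ℝ (Tan n x)) (i : Fin n)
    (g : Fin n → ℝ) : ∑ j, inner ℝ (b i) (b j) * g j = g i := by
  classical
  simp [b.inner_eq_ite]

theorem square_metric (hg : ∀ (y : M) (u v : Tan n y), φ y u v = inner ℝ u v) (h : M → ℝ) :
    square φ h = lap n h := by
  funext y
  simp only [square, hg, sum_inner_mul (onb y), lap]

theorem fluxB_metric (hg : ∀ (y : M) (u v : Tan n y), φ y u v = inner ℝ u v) (f : M → ℝ) :
    fluxB φ f = gradFlux n f := by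
  funext y v
  simp only [fluxB, gradFlux, hg, mul_comm (diff n f y _) (inner ℝ _ _), mul_assoc,
    sum_inner_mul (onb y)]

theorem sharp_metric (hg : ∀ (y : M) (u v : Tan n y), φ y u v = inner ℝ u v) (w : Tan n x) :
    sharp (φ x w) = w :=
  ext_inner_right ℝ fun v ↦ (sharp_inner (φ x w).toLinearMap v).trans (hg x w v)

theorem div_fluxB_metric (hg : ∀ (y : M) (u v : Tan n y), φ y u v = inner ℝ u v)
    (hf : ∀ y, FSmoothAt (n := n) f y) (x : M) :
    div (fluxB φ f) x = (1 / 2) * lap n (fun y ↦ ‖grad n f y‖ ^ 2) x := by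
  simp only [fluxB_metric hg, div, lap, hess_norm_grad_sq hf, ← Finset.mul_sum]
  ring

theorem ric_grad (f : M → ℝ) (e : OrthonormalBasis (Fin n) ℝ (Tan n x)) :
    ric (grad n f x) (grad n f x)
      = ∑ i, ∑ j, ∑ k, diff n f x ![e i] * diff n f x ![e j] * riem (e i) (e k) (e j) (e k) := by
  have h (k) : riem (grad n f x) (e k) (grad n f x) (e k)
      = ∑ i, ∑ j, diff n f x ![e i] * diff n f x ![e j] * riem (e i) (e k) (e j) (e k) := by
    conv_lhs => rw [grad_eq_sum f e]
    rw [isLinearMap_map_sum (riem_linear_one (e k) _ (e k))]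
    refine Finset.sum_congr rfl fun i _ ↦ ?_
    rw [isLinearMap_map_sum (riem_linear_three (e i) (e k) (e k)), Finset.mul_sum]
    exact Finset.sum_congr rfl fun j _ ↦ (mul_assoc _ _ _).symm
  rw [ric, sum_bilin_eq (B := fun u v ↦ riem (grad n f x) u (grad n f x) v)
    ⟨fun v ↦ riem_linear_two _ _ _, fun u ↦ riem_linear_four _ _ _⟩ (onb x) e]
  simp only [h]
  exact (sum_rotate _).symm

/-- The classical Bochner formula. -/
theorem bochner_metric (hφ : ∀ y, TSmoothAt (toTensor φ) y)
    (hg : ∀ (y : M) (u v : Tan n y), φ y u v = inner ℝ u v) (hf : ∀ y, FSmoothAt (n := n) f y)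
    (x : M) (e : OrthonormalBasis (Fin n) ℝ (Tan n x)) :
    lap n (fun y ↦ ‖grad n f y‖ ^ 2) x
      = 2 * inner ℝ (grad n f x) (grad n (lap n f) x)
        + 2 * ∑ i, ∑ j, hess n f x ![e i, e j] ^ 2
        + 2 * ric (grad n f x) (grad n f x) := by
  have hT : toTensor φ = metricTensor n M := by
    funext y v
    exact hg y _ _
  have h0 : covDeriv (toTensor φ) = fun _ _ ↦ 0 := by rw [hT, covDeriv_metricTensor]
  -- With c = 0 the trace term drops out without computing tr g; the other derivatives of φ vanish
  -- by `h0`.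
  have h := bochner_formula hφ (fun y u v ↦ by rw [hg, hg, real_inner_comm]) hf 0 x e
  rw [div_eq (covDeriv_fluxA (hφ x) (hf x) e 0 0).1.diff e, div_fluxB_metric hg hf] at h
  simp only [covDeriv_codazziForm (hφ x) 0 e, (covDeriv_fluxA (hφ x) (hf x) e _ _).2, h0,
    covDeriv_zero, square_metric hg, sharp_metric hg, hg, mul_assoc] at h
  have h1 : ∑ i, ∑ j, ∑ k, inner ℝ (e i) (e j) * (hess n f x ![e j, e k] * hess n f x ![e k, e i])
      = ∑ i, ∑ j, hess n f x ![e i, e j] ^ 2 := by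
    simp only [← Finset.mul_sum, sum_inner_mul e]
    refine Finset.sum_congr rfl fun i _ ↦ Finset.sum_congr rfl fun j _ ↦ ?_
    rw [hess_symm (hf x) (e j)]; ring
  have h2 : ∑ i, ∑ j, ∑ k, ∑ m, diff n f x ![e i] * (diff n f x ![e j]
      * (inner ℝ (e i) (e m) * riem (e m) (e k) (e j) (e k))) = ric (grad n f x) (grad n f x) := by
    simp only [← Finset.mul_sum, sum_inner_mul e, ric_grad f e, mul_assoc]
  rw [h1, h2] at h
  simp only [sub_self, mul_zero, zero_mul, Finset.sum_const_zero, add_zero, sub_zero] at h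
  linarith

end metric

end Bochner

end

open Bochner in
theorem theorem1p1 {n : ℕ} {M : Type*} [TopologicalSpace M]
    [ChartedSpace (EuclideanSpace ℝ (Fin n)) M] [IsManifold (𝓡 n) ∞ M]
    [RiemannianBundle (fun x : M ↦ TangentSpace (𝓡 n) x)]
    [IsContMDiffRiemannianBundle (𝓡 n) ∞ (EuclideanSpace ℝ (Fin n))
      (fun x : M ↦ TangentSpace (𝓡 n) x)]
    (φ : (x : M) → TangentSpace (𝓡 n) x →L[ℝ] TangentSpace (𝓡 n) x →L[ℝ] ℝ)
    (hφ : ContMDiff (𝓡 n)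
      ((𝓡 n).prod 𝓘(ℝ, EuclideanSpace ℝ (Fin n) →L[ℝ] EuclideanSpace ℝ (Fin n) →L[ℝ] ℝ)) ∞
      (fun x ↦ TotalSpace.mk' (EuclideanSpace ℝ (Fin n) →L[ℝ] EuclideanSpace ℝ (Fin n) →L[ℝ] ℝ)
        (E := fun x : M ↦ TangentSpace (𝓡 n) x →L[ℝ] TangentSpace (𝓡 n) x →L[ℝ] ℝ) x (φ x)))
    (hsymm : ∀ (x : M) (u v : TangentSpace (𝓡 n) x), φ x u v = φ x v u)
    (f : M → ℝ) (hf : ContMDiff (𝓡 n) 𝓘(ℝ, ℝ) ∞ f) (c : ℝ) (x : M)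
    (e : OrthonormalBasis (Fin n) ℝ (TangentSpace (𝓡 n) x)) :
    ((1 / 2) * square φ (fun y ↦ ‖grad n f y‖ ^ 2) x
      = inner ℝ (grad n f x) (grad n (square φ f) x)
        + inner ℝ (sharp (φ x (grad n f x))) (grad n (lap n f) x)
        + 2 * ∑ i, ∑ j, ∑ k, φ x (e i) (e j) * hess n f x ![e j, e k] * hess n f x ![e k, e i]
        + 2 * ∑ i, ∑ j, ∑ k, ∑ m, diff n f x ![e i] * diff n f x ![e j] * φ x (e i) (e m)
            * riem (e m) (e k) (e j) (e k)
        + c * ∑ i, ∑ j, hess n (tr φ) x ![e i, e j] * diff n f x ![e i] * diff n f x ![e j]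
        - ∑ i, ∑ j, diff n f x ![e i] * diff n f x ![e j]
            * ∑ k, covDeriv (covDeriv (toTensor φ)) x ![e i, e j, e k, e k]
        + ∑ i, ∑ j, diff n f x ![e i] * diff n f x ![e j]
            * covDeriv (codazziForm φ c) x ![e i, e j]
        + div (fluxA φ f) x
        - div (fluxB φ f) x)
    ∧ ((∀ (y : M) (u v : TangentSpace (𝓡 n) y), φ y u v = inner ℝ u v) →
        div (fluxB φ f) x = (1 / 2) * lap n (fun y ↦ ‖grad n f y‖ ^ 2) x
        ∧ lap n (fun y ↦ ‖grad n f y‖ ^ 2) x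
          = 2 * inner ℝ (grad n f x) (grad n (lap n f) x)
            + 2 * ∑ i, ∑ j, hess n f x ![e i, e j] ^ 2
            + 2 * ric (grad n f x) (grad n f x)) := by
  have hT (y : M) : TSmoothAt (toTensor φ) y := toTensor_smooth (hφ y)
  exact ⟨bochner_formula hT hsymm hf c x e, fun hg ↦
    ⟨div_fluxB_metric hg hf x, bochner_metric hT hg hf x e⟩⟩
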